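/- In Permutation-Mastermind (Black-Peg Mastermind with $n$ holes and $k=n$ colours, no repetition of colours) the codemaker chooses a secret permutation $y\in S_n$. The codebreaker adaptively queries permutations $x\in S_n$, and each query is answered by $\mathrm{black}(x,y)=|\{i\in\{1,\dots,n\}: x(i)=y(i)\}|$. Let $\sigma^1$ be the identity $(1,2,\dots,n)$ and let $\sigma^{j+1}$ arise from $\sigma^j$ by a circular shift to the right. There is a single deterministic polynomial-time algorithm for the codebreaker (one program and one polynomial $T$, for all $n$) such that the following holds for every $n\ge 1$ and every secret $y\in S_n$. Given $n$, and given access to $y$ only through the answers to its queries, the algorithm halts after at most $T(n)$ steps, all its queries are permutations, its first $n-1$ queries are $\sigma^1,\dots,\sigma^{n-1}$, its last query is $y$ and it outputs $y$. The total number of its queries, including the last one, is at most $$(n-3)\lceil\log_2 n\rceil+\tfrac52 n-1 .$$ -/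

import Mathlib

namespace Mastermind

/-- The answer of the codemaker in the Black-Peg game: the number of positions in which the two
codes coincide. Positions and colours are both numbered by `Fin n`, and codes are permutations. -/
def black {n : ℕ} (x y : Equiv.Perm (Fin n)) : ℕ :=
  (Finset.univ.filter fun i : Fin n => x i = y i).card

/-- The identity shifted `j` times circularly to the right, in one-line notation; for `n = 4`
these are `(0,1,2,3)`, `(3,0,1,2)`, `(2,3,0,1)`, `(1,2,3,0)`. -/
def cyclicShift (n j : ℕ) : Equiv.Perm (Fin n) :=
  (finRotate n)⁻¹ ^ j

/-- The memory of the codebreaker's machine: registers, and arrays, holding natural numbers. -/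
structure Memory where
  /-- the content of the register with the given name -/
  reg : ℕ → ℕ
  /-- `arr k i` is the entry with index `i` of the array with name `k` -/
  arr : ℕ → ℕ → ℕ

/-- At the start register `0` holds the number `n` of holes; everything else is zero. -/
def Memory.init (n : ℕ) : Memory where
  reg := fun k => if k = 0 then n else 0
  arr := fun _ _ => 0

/-- Writing `v` into register `k`. -/
def Memory.setReg (M : Memory) (k v : ℕ) : Memory where
  reg := Function.update M.reg k v
  arr := M.arr

/-- Writing `v` into the entry `i` of array `k`. -/
def Memory.setArr (M : Memory) (k i v : ℕ) : Memory where
  reg := M.reg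
  arr := Function.update M.arr k (Function.update (M.arr k) i v)

/-- Arithmetic expressions. There is no multiplication, so one operation lengthens the binary
representation of the numbers involved by at most one bit: up to a polynomial, the number of
elementary operations is the running time of a Turing machine. -/
inductive Expr where
  /-- a constant -/
  | lit (c : ℕ)
  /-- the content of register `k` -/
  | reg (k : ℕ)
  /-- the entry of array `k` at the index given by an expression -/
  | arr (k : ℕ) (i : Expr)
  /-- addition -/
  | add (e f : Expr)
  /-- subtraction, truncated at zero -/
  | sub (e f : Expr)
  /-- the integer part of one half -/
  | half (e : Expr)

/-- The value of an expression. -/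
def Expr.eval (M : Memory) : Expr → ℕ
  | .lit c => c
  | .reg k => M.reg k
  | .arr k i => M.arr k (i.eval M)
  | .add e f => e.eval M + f.eval M
  | .sub e f => e.eval M - f.eval M
  | .half e => e.eval M / 2

/-- The number of elementary operations in the evaluation of an expression. -/
def Expr.cost : Expr → ℕ
  | .lit _ => 1
  | .reg _ => 1
  | .arr _ i => i.cost + 1
  | .add e f => e.cost + f.cost + 1
  | .sub e f => e.cost + f.cost + 1
  | .half e => e.cost + 1

/-- Programs for the codebreaker. A program is a finite piece of syntax; it does not depend on
the number of holes or on the secret code. -/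
inductive Program where
  /-- do nothing -/
  | skip
  /-- write the value of an expression into register `k` -/
  | setReg (k : ℕ) (e : Expr)
  /-- write the value of `e` into array `k`, at the index given by `i` -/
  | setArr (k : ℕ) (i e : Expr)
  /-- first `p`, then `q` -/
  | seq (p q : Program)
  /-- `p` if the value of `e` is nonzero, otherwise `q` -/
  | ite (e : Expr) (p q : Program)
  /-- repeat `p` as long as the value of `e` is nonzero -/
  | loop (e : Expr) (p : Program)
  /-- guess the code in the entries `0, …, n - 1` of array `k`; put the answer into register `d` -/
  | query (k d : ℕ)

/-- `Run y p M M' t qs`: started with memory `M`, and with the codemaker answering according to the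
secret code `y`, the program `p` halts with memory `M'` after `t` steps, and `qs` is the list of
the codes it has guessed, in this order. A guess that is not a permutation is illegal: it has no
run. The secret is used for the answers to the guesses only. -/
inductive Run {n : ℕ} (y : Equiv.Perm (Fin n)) :
    Program → Memory → Memory → ℕ → List (Equiv.Perm (Fin n)) → Prop where
  | skip (M : Memory) : Run y .skip M M 1 []
  | setReg (M : Memory) (k : ℕ) (e : Expr) :
      Run y (.setReg k e) M (M.setReg k (e.eval M)) (e.cost + 1) []
  | setArr (M : Memory) (k : ℕ) (i e : Expr) :
      Run y (.setArr k i e) M (M.setArr k (i.eval M) (e.eval M)) (i.cost + e.cost + 1) []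
  | seq {p q : Program} {M₀ M₁ M₂ : Memory} {t₁ t₂ : ℕ} {qs₁ qs₂ : List (Equiv.Perm (Fin n))}
      (h₁ : Run y p M₀ M₁ t₁ qs₁) (h₂ : Run y q M₁ M₂ t₂ qs₂) :
      Run y (.seq p q) M₀ M₂ (t₁ + t₂) (qs₁ ++ qs₂)
  | iteTrue {e : Expr} {p q : Program} {M M' : Memory} {t : ℕ} {qs : List (Equiv.Perm (Fin n))}
      (he : e.eval M ≠ 0) (h : Run y p M M' t qs) :
      Run y (.ite e p q) M M' (e.cost + 1 + t) qs
  | iteFalse {e : Expr} {p q : Program} {M M' : Memory} {t : ℕ} {qs : List (Equiv.Perm (Fin n))}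
      (he : e.eval M = 0) (h : Run y q M M' t qs) :
      Run y (.ite e p q) M M' (e.cost + 1 + t) qs
  | loopDone {e : Expr} {p : Program} {M : Memory} (he : e.eval M = 0) :
      Run y (.loop e p) M M (e.cost + 1) []
  | loopStep {e : Expr} {p : Program} {M₀ M₁ M₂ : Memory} {t₁ t₂ : ℕ}
      {qs₁ qs₂ : List (Equiv.Perm (Fin n))} (he : e.eval M₀ ≠ 0)
      (h₁ : Run y p M₀ M₁ t₁ qs₁) (h₂ : Run y (.loop e p) M₁ M₂ t₂ qs₂) :
      Run y (.loop e p) M₀ M₂ (e.cost + 1 + t₁ + t₂) (qs₁ ++ qs₂)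
  | query (M : Memory) (k d : ℕ) (x : Equiv.Perm (Fin n))
      (hx : ∀ i : Fin n, M.arr k (i : ℕ) = (x i : ℕ)) :
      Run y (.query k d) M (M.setReg d (black x y)) (n + 1) [x]

/-- A program is deterministic: the secret code determines the guesses, the number of steps and
the final memory. -/
theorem Run.deterministic {n : ℕ} {y : Equiv.Perm (Fin n)} {p : Program} {M M₁ M₂ : Memory}
    {t₁ t₂ : ℕ} {qs₁ qs₂ : List (Equiv.Perm (Fin n))} (h₁ : Run y p M M₁ t₁ qs₁)
    (h₂ : Run y p M M₂ t₂ qs₂) : M₁ = M₂ ∧ t₁ = t₂ ∧ qs₁ = qs₂ := by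
  induction h₁ generalizing M₂ t₂ qs₂ with
  | skip => cases h₂; simp
  | setReg => cases h₂; simp
  | setArr => cases h₂; simp
  | seq _ _ ih₁ ih₂ =>
    cases h₂ with
    | seq g₁ g₂ =>
      obtain ⟨rfl, rfl, rfl⟩ := ih₁ g₁
      obtain ⟨rfl, rfl, rfl⟩ := ih₂ g₂
      simp
  | iteTrue he _ ih =>
    cases h₂ with
    | iteTrue _ g => obtain ⟨rfl, rfl, rfl⟩ := ih g; simp
    | iteFalse he' _ => exact absurd he' he
  | iteFalse he _ ih =>
    cases h₂ with
    | iteFalse _ g => obtain ⟨rfl, rfl, rfl⟩ := ih g; simp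
    | iteTrue he' _ => exact absurd he he'
  | loopDone he =>
    cases h₂ with
    | loopDone _ => simp
    | loopStep he' _ _ => exact absurd he he'
  | loopStep he _ _ ih₁ ih₂ =>
    cases h₂ with
    | loopDone he' => exact absurd he' he
    | loopStep _ g₁ g₂ =>
      obtain ⟨rfl, rfl, rfl⟩ := ih₁ g₁
      obtain ⟨rfl, rfl, rfl⟩ := ih₂ g₂
      simp
  | query M k d x hx =>
    cases h₂ with
    | query _ _ _ x' hx' =>
      obtain rfl : x = x' := Equiv.ext fun i => Fin.ext ((hx i).symm.trans (hx' i))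
      simp

end Mastermind

namespace Mastermind

-- Each position `i` lies on the diagonal `i - y i` modulo `n`, and the answer to the shift by `j`
-- is the number of positions on diagonal `j`. These numbers add up to `n`, so `n - 1` shifts reveal
-- all of them. Suppose some diagonal is empty. Going round the circle, there is a nonempty diagonal
-- `d` whose successor is empty. A hybrid guess follows the shift by `d` before a cut and the shift
-- by `d + 1` after it, with a filler colour `q` at the cut. Its second piece earns nothing, so its
-- answer counts the pegs of diagonal `d` before the cut, plus possibly the filler.
--
-- Once a peg is known, its colour serves as filler. Subtracting the hits at known positions leaves
-- exactly the unknown pegs of diagonal `d` before the cut, and binary search over the cut locates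
-- one of them with at most `clog 2 (n - 1)` guesses (`knownBlack_lt_black_hybrid_iff`,
-- `ends_halve`). Emptiness refers to unknown pegs only, so it persists as more pegs become known.
--
-- The first peg costs at most `n - 1` guesses. If some diagonal is empty, all cuts are tried with
-- filler `0`: the answer drops exactly when the cut leaves the true position of `0`
-- (`black_hybrid_succ_lt_iff`). If none is empty, every diagonal holds one peg; transpositions `(0
-- k)` single out the one correct peg of the identity (`black_swap_eq_zero_iff`), and recording it
-- empties its diagonal.
--
-- The searches stop when at most one peg is unknown, and that peg is determined by its diagonal and
-- its position. The total is at most `2 (n - 1) + (n - 2) clog 2 (n - 1) + 1`, which `query_bound`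
-- compares with the claim. The machine part is a small program logic with loop invariants.

infixr:60 " ;; " => Program.seq

/-! ### Reasoning about programs -/

/-- Started with memory `M`, the program `p` halts, and the final memory, the number of steps and
the list of guesses satisfy `Q`. -/
def Ends {n : ℕ} (y : Equiv.Perm (Fin n)) (p : Program) (M : Memory)
    (Q : Memory → ℕ → List (Equiv.Perm (Fin n)) → Prop) : Prop :=
  ∃ M' t qs, Run y p M M' t qs ∧ Q M' t qs

attribute [simp] Expr.eval Expr.cost

section Memory

variable (M : Memory) (k i v j l : ℕ)

@[simp] theorem Memory.setReg_reg : (M.setReg k v).reg j = if j = k then v else M.reg j := by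
  simp [Memory.setReg, Function.update_apply]

@[simp] theorem Memory.setReg_arr : (M.setReg k v).arr = M.arr := rfl

@[simp] theorem Memory.setArr_reg : (M.setArr k i v).reg = M.reg := rfl

@[simp] theorem Memory.setArr_arr :
    (M.setArr k i v).arr j l = if j = k ∧ l = i then v else M.arr j l := by
  by_cases h : j = k <;> by_cases h' : l = i <;>
    simp [Memory.setArr, h, h']

end Memory

section Rules

variable {n : ℕ} {y : Equiv.Perm (Fin n)} {M : Memory}
  {Q R : Memory → ℕ → List (Equiv.Perm (Fin n)) → Prop}

theorem Ends.mono {p : Program} (h : Ends y p M Q) (hQ : ∀ M' t qs, Q M' t qs → R M' t qs) :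
    Ends y p M R := by
  obtain ⟨M', t, qs, hr, h⟩ := h
  exact ⟨M', t, qs, hr, hQ _ _ _ h⟩

/-- This and the following rules are equivalences of weakest-precondition type, so that rewriting
with them executes straight-line code symbolically. Only guesses and loops need extra input: a
permutation, or an invariant. -/
theorem ends_skip : Ends y .skip M Q ↔ Q M 1 [] :=
  ⟨fun ⟨_, _, _, hr, h⟩ => by cases hr; exact h, fun h => ⟨_, _, _, .skip M, h⟩⟩

theorem ends_setReg {k : ℕ} {e : Expr} :
    Ends y (.setReg k e) M Q ↔ Q (M.setReg k (e.eval M)) (e.cost + 1) [] :=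
  ⟨fun ⟨_, _, _, hr, h⟩ => by cases hr; exact h, fun h => ⟨_, _, _, .setReg M k e, h⟩⟩

theorem ends_setArr {k : ℕ} {i e : Expr} :
    Ends y (.setArr k i e) M Q ↔
      Q (M.setArr k (i.eval M) (e.eval M)) (i.cost + e.cost + 1) [] :=
  ⟨fun ⟨_, _, _, hr, h⟩ => by cases hr; exact h, fun h => ⟨_, _, _, .setArr M k i e, h⟩⟩

theorem ends_seq {p q : Program} :
    Ends y (p ;; q) M Q ↔ Ends y p M fun M₁ t₁ qs₁ =>
      Ends y q M₁ fun M₂ t₂ qs₂ => Q M₂ (t₁ + t₂) (qs₁ ++ qs₂) := by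
  constructor
  · rintro ⟨_, _, _, hr, h⟩
    cases hr with
    | seq h₁ h₂ => exact ⟨_, _, _, h₁, _, _, _, h₂, h⟩
  · rintro ⟨_, _, _, h₁, _, _, _, h₂, h⟩
    exact ⟨_, _, _, h₁.seq h₂, h⟩

theorem ends_ite {e : Expr} {p q : Program} :
    Ends y (.ite e p q) M Q ↔
      if e.eval M = 0 then Ends y q M fun M' t qs => Q M' (e.cost + 1 + t) qs
      else Ends y p M fun M' t qs => Q M' (e.cost + 1 + t) qs := by
  split_ifs with he
  · constructor
    · rintro ⟨_, _, _, hr, h⟩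
      cases hr with
      | iteTrue he' _ => exact absurd he he'
      | iteFalse _ hr => exact ⟨_, _, _, hr, h⟩
    · rintro ⟨_, _, _, hr, h⟩
      exact ⟨_, _, _, .iteFalse he hr, h⟩
  · constructor
    · rintro ⟨_, _, _, hr, h⟩
      cases hr with
      | iteFalse he' _ => exact absurd he' he
      | iteTrue _ hr => exact ⟨_, _, _, hr, h⟩
    · rintro ⟨_, _, _, hr, h⟩
      exact ⟨_, _, _, .iteTrue he hr, h⟩

theorem ends_query {k d : ℕ} (x : Equiv.Perm (Fin n)) (hx : ∀ i : Fin n, M.arr k i = x i)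
    (h : Q (M.setReg d (black x y)) (n + 1) [x]) : Ends y (.query k d) M Q :=
  ⟨_, _, _, .query M k d x hx, h⟩

/-- The rule for loops, with an invariant `I`, a variant `μ` and a bound `c` on the time that one
round takes. -/
theorem ends_loop {e : Expr} {p : Program} (I : Memory → List (Equiv.Perm (Fin n)) → Prop)
    (μ : Memory → ℕ) (c : ℕ) (h₀ : I M [])
    (h : ∀ M qs, I M qs → e.eval M ≠ 0 →
      Ends y p M fun M' t qs' => t ≤ c ∧ I M' (qs ++ qs') ∧ μ M' < μ M) :
    Ends y (.loop e p) M fun M' t qs =>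
      I M' qs ∧ e.eval M' = 0 ∧ t ≤ (μ M + 1) * (c + e.cost + 1) := by
  -- The invariant refers to all guesses since the loop began, so the induction carries an arbitrary
  -- prefix `qs`.
  suffices H : ∀ N M qs, μ M ≤ N → I M qs → Ends y (.loop e p) M fun M' t qs' =>
      I M' (qs ++ qs') ∧ e.eval M' = 0 ∧ t ≤ (μ M + 1) * (c + e.cost + 1) by
    simpa using H _ M [] le_rfl h₀
  intro N
  induction N with
  | zero =>
    intro M qs hN hI
    by_cases he : e.eval M = 0
    · exact ⟨_, _, _, .loopDone he, by simpa, he, by nlinarith⟩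
    · obtain ⟨_, _, _, _, _, _, hlt⟩ := h M qs hI he
      omega
  | succ N ih =>
    intro M qs hN hI
    by_cases he : e.eval M = 0
    · exact ⟨_, _, _, .loopDone he, by simpa, he, by nlinarith⟩
    · obtain ⟨M₁, t₁, qs₁, hr, ht, hI₁, hlt⟩ := h M qs hI he
      obtain ⟨M₂, t₂, qs₂, hr₂, hI₂, he₂, ht₂⟩ := ih M₁ (qs ++ qs₁) (by omega) hI₁
      refine ⟨_, _, _, .loopStep he hr hr₂, by simpa using hI₂, he₂, ?_⟩
      have : (μ M₁ + 1) * (c + e.cost + 1) ≤ μ M * (c + e.cost + 1) :=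
        Nat.mul_le_mul_right _ hlt
      linarith

end Rules

/-! ### Diagonals -/

theorem add_mod_cancel {n a s t : ℕ} (hs : s < n) (ht : t < n) (h : (a + s) % n = (a + t) % n) :
    s = t := by
  have := Nat.ModEq.add_left_cancel' a h
  rwa [Nat.ModEq, Nat.mod_eq_of_lt hs, Nat.mod_eq_of_lt ht] at this

theorem exists_add_mod {n : ℕ} (a i : ℕ) (hi : i < n) : ∃ t < n, (a + t) % n = i := by
  have hinj : Function.Injective fun t : Fin n => (⟨(a + t) % n, Nat.mod_lt _ (by omega)⟩ : Fin n) :=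
    fun s t h => Fin.ext (add_mod_cancel s.2 t.2 (Fin.mk.inj h))
  obtain ⟨t, ht⟩ := Finite.injective_iff_surjective.1 hinj ⟨i, hi⟩
  exact ⟨t, t.2, congrArg Fin.val ht⟩

section

variable {n : ℕ} (y : Equiv.Perm (Fin n))

/-- The shift that makes the peg of `y` at position `i` correct. -/
def diag (i : Fin n) : ℕ := (n + i - y i) % n

theorem diag_lt (i : Fin n) : diag y i < n := Nat.mod_lt _ i.pos

theorem add_diag_mod (i : Fin n) : ((y i : ℕ) + diag y i) % n = i := by
  have h := (y i).2
  rw [diag, Nat.add_mod_mod, show (y i : ℕ) + (n + i - y i) = i + n by omega, Nat.add_mod_right,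
    Nat.mod_eq_of_lt i.2]

theorem diag_eq_iff {i : Fin n} {d : ℕ} (hd : d < n) :
    diag y i = d ↔ ((y i : ℕ) + d) % n = i := by
  constructor
  · rintro rfl
    exact add_diag_mod y i
  · intro h
    exact add_mod_cancel (diag_lt y i) hd ((add_diag_mod y i).trans h.symm)

/-- The number of positions outside `S` whose peg lies on the diagonal `d`. -/
def count (S : Finset (Fin n)) (d : ℕ) : ℕ :=
  (Finset.univ.filter fun i : Fin n => i ∉ S ∧ diag y i = d).card

theorem count_pos_iff {S : Finset (Fin n)} {d : ℕ} :
    0 < count y S d ↔ ∃ i, i ∉ S ∧ diag y i = d := by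
  simp [count, Finset.card_pos, Finset.Nonempty]

theorem count_eq_zero_iff {S : Finset (Fin n)} {d : ℕ} :
    count y S d = 0 ↔ ∀ i, i ∉ S → diag y i ≠ d := by
  simp [count, Finset.filter_eq_empty_iff]

theorem count_insert {S : Finset (Fin n)} {i : Fin n} (hi : i ∉ S) (d : ℕ) :
    count y (insert i S) d = if d = diag y i then count y S d - 1 else count y S d := by
  split_ifs with h
  · subst h
    rw [count, count, ← Finset.card_erase_of_mem (a := i) (by simp [hi])]
    congr 1
    ext j
    simp only [Finset.mem_filter, Finset.mem_univ, true_and, Finset.mem_insert, Finset.mem_erase]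
    tauto
  · rw [count, count]
    congr 1
    ext j
    simp only [Finset.mem_filter, Finset.mem_univ, true_and, Finset.mem_insert]
    constructor
    · tauto
    · rintro ⟨h1, rfl⟩
      refine ⟨?_, rfl⟩
      rintro (rfl | h2)
      · exact h rfl
      · exact h1 h2

theorem sum_count_empty : ∑ d ∈ Finset.range n, count y ∅ d = n := by
  have := Finset.card_eq_sum_card_fiberwise (s := (Finset.univ : Finset (Fin n)))
    (t := Finset.range n) (f := diag y) (fun i _ => by simpa using diag_lt y i)
  simpa [count] using this.symm

/-- There are `n` numbers, each at least `1`, with sum `n`. -/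
theorem count_empty_eq_one (h : ∀ d < n, count y ∅ d ≠ 0) {d : ℕ} (hd : d < n) :
    count y ∅ d = 1 := by
  have h1 : ∀ d ∈ Finset.range n, 1 ≤ count y ∅ d := fun d hd =>
    Nat.one_le_iff_ne_zero.2 (h d (by simpa using hd))
  have := (Finset.sum_eq_sum_iff_of_le h1).1 (by simp [sum_count_empty])
  exact (this d (by simpa using hd)).symm

end

/-- Otherwise being nonzero would propagate from one residue around the whole circle. -/
theorem exists_pos_zero_succ {n : ℕ} (f : ℕ → ℕ) (hpos : ∃ d < n, f d ≠ 0)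
    (hzero : ∃ d < n, f d = 0) : ∃ d < n, f d ≠ 0 ∧ f ((d + 1) % n) = 0 := by
  obtain ⟨a, ha, hfa⟩ := hpos
  obtain ⟨b, hb, hfb⟩ := hzero
  by_contra! h
  have key : ∀ k, f ((a + k) % n) ≠ 0 := by
    intro k
    induction k with
    | zero => simpa [Nat.mod_eq_of_lt ha] using hfa
    | succ k ih => simpa [Nat.add_assoc] using h _ (Nat.mod_lt _ (by omega)) ih
  obtain ⟨t, _, rfl⟩ := exists_add_mod a b hb
  exact key t hfb

/-! ### Hybrids of neighbouring shifts -/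

/-- The colour at offset `t`, counted from the colour at offset `m`, in a hybrid that changes from
one shift to the next at offset `m`. -/
def slot (m t : ℕ) : ℕ := if t < m then t + 1 else if m < t then t else 0

theorem slot_lt {n m t : ℕ} (hm : m < n) (ht : t < n) : slot m t < n := by
  unfold slot; split_ifs <;> omega

theorem slot_injective {m s t : ℕ} (h : slot m s = slot m t) : s = t := by
  unfold slot at h; split_ifs at h <;> omega

/-- Offsets enumerate the positions bijectively, and through `slot m` also the colours; the hybrid
is one enumeration composed with the inverse of the other. -/
theorem exists_hybrid (n d q m : ℕ) (hm : m < n) : ∃ x : Equiv.Perm (Fin n), ∀ t < n, ∀ i : Fin n,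
    (i : ℕ) = (q + d + 1 + t) % n → (x i : ℕ) = (q + slot m t) % n := by
  have hn : 0 < n := by omega
  let pos : Fin n → Fin n := fun t => ⟨(q + d + 1 + t) % n, Nat.mod_lt _ hn⟩
  let col : Fin n → Fin n := fun t => ⟨(q + slot m t) % n, Nat.mod_lt _ hn⟩
  have hpos : Function.Injective pos := fun s t h =>
    Fin.ext (add_mod_cancel s.2 t.2 (Fin.mk.inj h))
  have hcol : Function.Injective col := fun s t h =>
    Fin.ext (slot_injective (add_mod_cancel (slot_lt hm s.2) (slot_lt hm t.2) (Fin.mk.inj h)))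
  refine ⟨(Equiv.ofBijective pos (Finite.injective_iff_bijective.1 hpos)).symm.trans
    (Equiv.ofBijective col (Finite.injective_iff_bijective.1 hcol)), fun t ht i hi => ?_⟩
  have : i = Equiv.ofBijective pos (Finite.injective_iff_bijective.1 hpos) ⟨t, ht⟩ := Fin.ext hi
  rw [this, Equiv.trans_apply, Equiv.symm_apply_apply]
  rfl

open Classical in
/-- Position `q + d + 1 + t` has offset `t`. Up to offset `m` this is the shift by `d`, beyond it
the shift by `d + 1`, and at offset `m` it has the remaining colour `q`. -/
noncomputable def hybrid (n d q m : ℕ) : Equiv.Perm (Fin n) :=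
  if hm : m < n then (exists_hybrid n d q m hm).choose else 1

section Hybrid

variable {n d q m t : ℕ} {i : Fin n}

theorem hybrid_apply (hm : m < n) (ht : t < n) (hi : (i : ℕ) = (q + d + 1 + t) % n) :
    (hybrid n d q m i : ℕ) = (q + slot m t) % n := by
  rw [hybrid, dif_pos hm]
  exact (exists_hybrid n d q m hm).choose_spec t ht i hi

theorem finRotate_pow_apply (j : ℕ) (i : Fin n) : (((finRotate n) ^ j) i : ℕ) = (i + j) % n := by
  obtain _ | n := n
  · exact i.elim0
  induction j with
  | zero => simp [Nat.mod_eq_of_lt i.2]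
  | succ j ih =>
    rw [pow_succ', Equiv.Perm.mul_apply, finRotate_apply, Fin.val_add, ih, Fin.val_one']
    simp [Nat.add_assoc]

theorem cyclicShift_apply_eq_iff {j : ℕ} {i k : Fin n} :
    cyclicShift n j i = k ↔ ((k : ℕ) + j) % n = i := by
  rw [cyclicShift, inv_pow, Equiv.Perm.inv_eq_iff_eq, Fin.ext_iff, finRotate_pow_apply]
  exact eq_comm

/-- With the cut at the last offset, the filler is the colour that the shift by `j` has there
anyway. Thus the routine for hybrids also produces the shifts. -/
theorem hybrid_eq_cyclicShift {j : ℕ} (hn : 0 < n) :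
    hybrid n j 0 (n - 1) = cyclicShift n j := by
  ext i
  obtain ⟨t, ht, hi⟩ := exists_add_mod (0 + j + 1) i i.2
  rw [← Fin.ext_iff, eq_comm, cyclicShift_apply_eq_iff, hybrid_apply (by omega) ht hi.symm, ← hi]
  have : (0 + slot (n - 1) t) % n = (t + 1) % n := by
    unfold slot
    split_ifs with h1 h2
    · simp
    · omega
    · rw [show t + 1 = n by omega]; simp
  rw [this, Nat.mod_add_mod]
  congr 1
  omega

variable (y : Equiv.Perm (Fin n))

theorem black_cyclicShift {j : ℕ} (hj : j < n) : black (cyclicShift n j) y = count y ∅ j := by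
  simp [black, count, cyclicShift_apply_eq_iff, diag_eq_iff y hj]

theorem apply_eq_of_diag_eq (hi : (i : ℕ) = (q + d + 1 + t) % n) (h : diag y i = d) :
    (y i : ℕ) = (q + (t + 1)) % n := by
  have := add_diag_mod y i
  rw [hi, h, show q + d + 1 + t = q + (t + 1) + d by omega] at this
  have h2 : (y i : ℕ) ≡ q + (t + 1) [MOD n] := Nat.ModEq.add_right_cancel' d this
  rwa [Nat.ModEq, Nat.mod_eq_of_lt (y i).2] at h2

theorem diag_eq_of_apply_eq (hd : d < n) (hi : (i : ℕ) = (q + d + 1 + t) % n)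
    (h : (y i : ℕ) = (q + (t + 1)) % n) : diag y i = d := by
  rw [diag_eq_iff y hd, h, hi, Nat.mod_add_mod]
  congr 1; omega

theorem diag_eq_succ_of_apply_eq (hi : (i : ℕ) = (q + d + 1 + t) % n)
    (h : (y i : ℕ) = (q + t) % n) : diag y i = (d + 1) % n := by
  rw [diag_eq_iff y (Nat.mod_lt _ i.pos), h, hi, ← Nat.add_mod]
  congr 1; omega

/-- The comparisons of hybrid answers below rest on this trichotomy: before the cut, after it, at
it. -/
theorem hybrid_apply_eq_iff (hd : d < n) (hq : q < n) (hm : m < n) (ht : t < n)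
    (hi : (i : ℕ) = (q + d + 1 + t) % n) :
    hybrid n d q m i = y i ↔
      (t < m ∧ diag y i = d) ∨ (m < t ∧ diag y i = (d + 1) % n) ∨ (t = m ∧ (y i : ℕ) = q) := by
  rw [Fin.ext_iff, hybrid_apply hm ht hi]
  rcases lt_trichotomy t m with h | h | h
  · simp only [slot, h, if_true, h.not_gt, h.ne, false_and, or_false, true_and]
    exact ⟨fun h' => diag_eq_of_apply_eq y hd hi h'.symm, fun h' => (apply_eq_of_diag_eq y hi h').symm⟩
  · simp only [slot, h, lt_irrefl, if_false, false_and, false_or, true_and, add_zero,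
      Nat.mod_eq_of_lt hq]
    exact eq_comm
  · simp only [slot, h, if_true, h.not_gt, h.ne', if_false, false_and, false_or, or_false, true_and]
    refine ⟨fun h' => diag_eq_succ_of_apply_eq y hi h'.symm, fun h' => ?_⟩
    have := (diag_eq_iff y (Nat.mod_lt _ i.pos)).1 h'
    rw [hi, Nat.add_mod_mod, show q + d + 1 + t = q + t + (d + 1) by omega] at this
    have h2 : (y i : ℕ) ≡ q + t [MOD n] := Nat.ModEq.add_right_cancel' (d + 1) this
    rwa [Nat.ModEq, Nat.mod_eq_of_lt (y i).2, eq_comm] at h2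

/-- With the cut at offset `0` the filler also lies on diagonal `d + 1`, so the guess is the shift
by `d + 1`. -/
theorem black_hybrid_zero (hd : d < n) (hq : q < n) (h : count y ∅ ((d + 1) % n) = 0) :
    black (hybrid n d q 0) y = 0 := by
  have h' : ∀ j, diag y j ≠ (d + 1) % n := by simpa using (count_eq_zero_iff y).1 h
  rw [black, Finset.card_eq_zero, Finset.filter_eq_empty_iff]
  intro j _
  obtain ⟨t, ht, hj⟩ := exists_add_mod (q + d + 1) j j.2
  rw [hybrid_apply_eq_iff y hd hq (by omega) ht hj.symm]
  rintro (⟨h1, -⟩ | ⟨-, h2⟩ | ⟨rfl, h2⟩)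
  · omega
  · exact h' j h2
  · exact h' j (diag_eq_succ_of_apply_eq y hj.symm (by rw [h2, add_zero, Nat.mod_eq_of_lt hq]))

/-- Moving the change of shift by one offset decreases the answer exactly if the colour `q` was
correct. -/
theorem black_hybrid_succ_lt_iff (hd : d < n) (hq : q < n) (hm : m + 1 < n)
    (h : count y ∅ ((d + 1) % n) = 0) (hi : (i : ℕ) = (q + d + 1 + m) % n) :
    black (hybrid n d q (m + 1)) y < black (hybrid n d q m) y ↔ (y i : ℕ) = q := by
  have h' : ∀ j, diag y j ≠ (d + 1) % n := by simpa using (count_eq_zero_iff y).1 h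
  constructor
  · contrapose!
    intro hne
    -- If the filler is wrong at offset `m`, moving the cut loses no hit: only pegs on diagonal `d`
    -- before the cut counted, and they still do.
    refine Finset.card_le_card fun j => ?_
    obtain ⟨t, ht, hj⟩ := exists_add_mod (q + d + 1) j j.2
    simp only [Finset.mem_filter, Finset.mem_univ, true_and,
      hybrid_apply_eq_iff y hd hq hm ht hj.symm,
      hybrid_apply_eq_iff y hd hq (Nat.lt_of_succ_lt hm) ht hj.symm, h', and_false, false_or]
    rintro (⟨h1, h2⟩ | ⟨rfl, h2⟩)
    · exact Or.inl ⟨by omega, h2⟩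
    · exact absurd (by rw [← h2, Fin.ext (hi.trans hj)]) hne
  · intro he
    refine Finset.card_lt_card (Finset.ssubset_iff_of_subset ?_ |>.2 ⟨i, ?_, ?_⟩)
    · intro j
      obtain ⟨t, ht, hj⟩ := exists_add_mod (q + d + 1) j j.2
      simp only [Finset.mem_filter, Finset.mem_univ, true_and,
        hybrid_apply_eq_iff y hd hq hm ht hj.symm,
        hybrid_apply_eq_iff y hd hq (Nat.lt_of_succ_lt hm) ht hj.symm, h', and_false, false_or]
      rintro (⟨h1, h2⟩ | ⟨rfl, h2⟩)
      · obtain h3 | rfl := Nat.lt_succ_iff_lt_or_eq.1 h1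
        · exact Or.inl ⟨h3, h2⟩
        · obtain rfl : i = j := Fin.ext (hi.trans hj)
          exact Or.inr ⟨rfl, he⟩
      · have : i = j := y.injective (Fin.ext (he.trans h2.symm))
        subst this
        have := add_mod_cancel (by omega) ht (hi.symm.trans hj.symm)
        omega
    · simp [hybrid_apply_eq_iff y hd hq (Nat.lt_of_succ_lt hm) (Nat.lt_of_succ_lt hm) hi, he]
    · rw [Finset.mem_filter, hybrid_apply_eq_iff y hd hq hm (Nat.lt_of_succ_lt hm) hi]
      -- On diagonal `d` the colour at offset `m` would be `q + m + 1`, which differs from `q`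
      -- modulo `n` because `m + 1 < n`.
      have h3 : diag y i ≠ d := by
        intro h3
        have h4 := apply_eq_of_diag_eq y hi h3
        rw [he] at h4
        have := add_mod_cancel (a := q) (s := 0) (by omega) hm
          (by rw [add_zero, Nat.mod_eq_of_lt hq]; exact h4)
        omega
      simp [h', h3]

/-- A swap that avoids `e` keeps that hit. A swap that moves `e` destroys it and creates none, since
position `e` and colour `e` are matched to each other in `y`. -/
theorem black_swap_eq_zero_iff (h : count y ∅ 0 = 1) {e : Fin n} (he : y e = e) {k l : Fin n}
    (hkl : k ≠ l) : black (Equiv.swap k l) y = 0 ↔ e = k ∨ e = l := by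
  have huniq : ∀ i, y i = i → i = e := by
    intro i hi
    have hn := i.pos
    refine Finset.card_le_one.1 h.le i ?_ e ?_ <;>
      simp [diag_eq_iff y hn, hi, he, Nat.mod_eq_of_lt]
  rw [black, Finset.card_eq_zero, Finset.filter_eq_empty_iff]
  constructor
  · intro h'
    by_contra! hne
    exact h' (Finset.mem_univ e) (by rw [Equiv.swap_apply_of_ne_of_ne hne.1 hne.2, he])
  · rintro hor i -
    rcases eq_or_ne i k with rfl | hik
    · rw [Equiv.swap_apply_left]
      rintro hl
      rcases hor with rfl | rfl
      · exact hkl (he ▸ hl).symm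
      · exact hkl (y.injective (hl.symm.trans he.symm))
    rcases eq_or_ne i l with rfl | hil
    · rw [Equiv.swap_apply_right]
      rintro hl
      rcases hor with rfl | rfl
      · exact hkl (y.injective (he.trans hl))
      · exact hkl (he ▸ hl)
    · rw [Equiv.swap_apply_of_ne_of_ne hik hil]
      intro h'
      have := huniq i h'.symm
      subst this
      exact hor.elim hik hil

end Hybrid

/-! ### The parts of the program

Register `0` holds `n`. Register `2` receives the answers, and registers `4`, `5`, `6` hold the
parameters `d`, `q`, `m` of the next hybrid guess. Register `12` holds the number of positions
whose peg is not known. Array `0` holds the known pegs, array `1` the number of unknown pegs on each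
diagonal, array `2` the next guess, array `3` the marks of the known positions, and array `4`
a table of residues modulo `n`. -/

/-- The memories `M` and `M'` differ at most in the registers `rs` and the arrays `as`. -/
def Frame (rs as : List ℕ) (M M' : Memory) : Prop :=
  (∀ k, k ∉ rs → M'.reg k = M.reg k) ∧ ∀ k, k ∉ as → M'.arr k = M.arr k

namespace Frame

variable {rs as rs' as' : List ℕ} {M M₁ M₂ : Memory} {k v : ℕ}

theorem refl : Frame rs as M M := ⟨fun _ _ => rfl, fun _ _ => rfl⟩

theorem setReg (h : Frame rs as M M₁) (hk : k ∈ rs) : Frame rs as M (M₁.setReg k v) :=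
  ⟨fun j hj => by rw [Memory.setReg_reg, if_neg (by rintro rfl; exact hj hk), h.1 j hj], h.2⟩

theorem setArr {i : ℕ} (h : Frame rs as M M₁) (hk : k ∈ as) :
    Frame rs as M (M₁.setArr k i v) :=
  ⟨h.1, fun j hj =>
    (Function.update_of_ne (by rintro rfl; exact hj hk) _ _).trans (h.2 j hj)⟩

theorem trans (h : Frame rs as M M₁) (h' : Frame rs' as' M₁ M₂) (hr : rs' ⊆ rs) (ha : as' ⊆ as) :
    Frame rs as M M₂ :=
  ⟨fun k hk => (h'.1 k fun h => hk (hr h)).trans (h.1 k hk),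
    fun k hk => (h'.2 k fun h => hk (ha h)).trans (h.2 k hk)⟩

end Frame

/-- Filling the table of residues. -/
def mkTable : Program :=
  .setReg 3 (.lit 0) ;;
  .loop (.sub (.reg 0) (.reg 3))
    (.setArr 4 (.reg 3) (.reg 3) ;;
      .setArr 4 (.add (.reg 0) (.reg 3)) (.reg 3) ;;
      .setArr 4 (.add (.reg 0) (.add (.reg 0) (.reg 3))) (.reg 3) ;;
      .setReg 3 (.add (.reg 3) (.lit 1)))

/-- Writing the hybrid with parameters `d`, `q`, `m` into array `2`. -/
def build : Program :=
  .setReg 3 (.lit 0) ;;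
  .loop (.sub (.reg 0) (.reg 3))
    (.setArr 2 (.arr 4 (.add (.reg 5) (.add (.reg 4) (.add (.lit 1) (.reg 3)))))
        (.arr 4 (.add (.reg 5) (.reg 3))) ;;
      .ite (.sub (.reg 6) (.reg 3))
        (.setArr 2 (.arr 4 (.add (.reg 5) (.add (.reg 4) (.add (.lit 1) (.reg 3)))))
          (.arr 4 (.add (.reg 5) (.add (.reg 3) (.lit 1)))))
        (.ite (.sub (.reg 3) (.reg 6)) .skip
          (.setArr 2 (.arr 4 (.add (.reg 5) (.add (.reg 4) (.add (.lit 1) (.reg 3)))))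
            (.reg 5))) ;;
      .setReg 3 (.add (.reg 3) (.lit 1)))

/-- Guessing a hybrid. -/
def ask : Program := build ;; .query 2 2

/-- Searching a diagonal `d` with an unknown peg such that `d + 1` has none. -/
def find : Program :=
  -- The value `n` is no diagonal and signals that the search failed.
  .setReg 4 (.reg 0) ;;
  .setReg 1 (.lit 0) ;;
  .loop (.sub (.reg 0) (.reg 1))
    (.ite (.arr 1 (.reg 1))
        (.ite (.arr 1 (.arr 4 (.add (.reg 1) (.lit 1)))) .skip (.setReg 4 (.reg 1))) .skip ;;
      .setReg 1 (.add (.reg 1) (.lit 1)))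

/-- Recording that position `reg 10` has the colour `reg 11`. -/
def record : Program :=
  .setArr 0 (.reg 10) (.reg 11) ;;
  .setArr 3 (.reg 10) (.lit 1) ;;
  .setArr 1 (.arr 4 (.sub (.add (.reg 0) (.reg 10)) (.reg 11)))
    (.sub (.arr 1 (.arr 4 (.sub (.add (.reg 0) (.reg 10)) (.reg 11)))) (.lit 1)) ;;
  .setReg 12 (.sub (.reg 12) (.lit 1))

/-! ### Memory invariants and the elementary routines -/

/-- Register `0` holds `n`, and the table of residues is filled. -/
def Base (n : ℕ) (M : Memory) : Prop := M.reg 0 = n ∧ ∀ i < 3 * n, M.arr 4 i = i % n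

theorem Base.frame {n : ℕ} {M M' : Memory} {rs as : List ℕ} (h : Base n M) (hf : Frame rs as M M')
    (hr : 0 ∉ rs) (ha : 4 ∉ as) : Base n M' :=
  ⟨(hf.1 0 hr).trans h.1, by rw [hf.2 4 ha]; exact h.2⟩

/-- The pegs at the positions `S` are known. -/
structure Known {n : ℕ} (y : Equiv.Perm (Fin n)) (S : Finset (Fin n)) (M : Memory) : Prop where
  base : Base n M
  rest : M.reg 12 + S.card = n
  peg : ∀ i ∈ S, M.arr 0 i = y i
  mark : ∀ i : Fin n, M.arr 3 i = if i ∈ S then 1 else 0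
  count : ∀ d < n, M.arr 1 d = count y S d

section

variable {n : ℕ} {y : Equiv.Perm (Fin n)} {M M' : Memory} {S : Finset (Fin n)}

theorem Known.frame {rs as : List ℕ} (h : Known y S M) (hf : Frame rs as M M')
    (hr : 0 ∉ rs ∧ 12 ∉ rs) (ha : 0 ∉ as ∧ 1 ∉ as ∧ 3 ∉ as ∧ 4 ∉ as) : Known y S M' where
  base := h.base.frame hf hr.1 ha.2.2.2
  rest := by rw [hf.1 12 hr.2]; exact h.rest
  peg := by rw [hf.2 0 ha.1]; exact h.peg
  mark := by rw [hf.2 3 ha.2.2.1]; exact h.mark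
  count := by rw [hf.2 1 ha.2.1]; exact h.count

theorem ends_mkTable (h : M.reg 0 = n) : Ends y mkTable M fun M' t qs =>
    qs = [] ∧ t ≤ 100 * (n + 1) ∧ Base n M' ∧ Frame [3] [4] M M' := by
  simp only [mkTable, ends_seq, ends_setReg]
  refine (ends_loop (fun M' qs => qs = [] ∧ Frame [3] [4] M M' ∧ M'.reg 3 ≤ n ∧
    ∀ i < M'.reg 3, M'.arr 4 i = i ∧ M'.arr 4 (n + i) = i ∧ M'.arr 4 (n + (n + i)) = i)
    (fun M' => n - M'.reg 3) 40 ?_ ?_).mono ?_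
  · exact ⟨rfl, Frame.refl.setReg (by simp), by simp [Memory.setReg_reg, Expr.eval],
      by simp [Memory.setReg_reg, Expr.eval]⟩
  · rintro M₁ qs ⟨rfl, hf, h3, hA⟩ he
    have h0 : M₁.reg 0 = n := by rw [hf.1 0 (by simp), h]
    simp only [Expr.eval, h0] at he
    simp only [ends_setReg, ends_setArr, ends_seq, Expr.eval, Expr.cost, Memory.setReg_reg,
      Memory.setArr_reg, Memory.setReg_arr, Memory.setArr_arr, h0]
    refine ⟨by norm_num, ⟨by simp, (((hf.setArr (by simp)).setArr (by simp)).setArr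
      (by simp)).setReg (by simp), by simp; omega, ?_⟩, by simp; omega⟩
    intro i hi
    simp only [if_true] at hi
    obtain hi | rfl := Nat.lt_succ_iff_lt_or_eq.1 hi
    · obtain ⟨h1, h2, h3⟩ := hA i hi
      refine ⟨?_, ?_, ?_⟩ <;> simp only [true_and] <;> (repeat rw [if_neg (by omega)]) <;> assumption
    · simp
  · rintro M₁ t qs ⟨⟨rfl, hf, h3, hA⟩, he, ht⟩
    have h0 : M₁.reg 0 = n := by rw [hf.1 0 (by simp), h]
    simp only [Expr.eval, h0] at he
    simp [Expr.cost, Memory.setReg_reg, Expr.eval] at ht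
    refine ⟨rfl, by simp [Expr.cost]; omega, ⟨h0, fun i hi => ?_⟩, hf⟩
    by_cases h1 : i < n
    · rw [(hA i (by omega)).1, Nat.mod_eq_of_lt h1]
    by_cases h2 : i < 2 * n
    · obtain ⟨j, rfl⟩ := Nat.exists_eq_add_of_le (not_lt.1 h1)
      rw [(hA j (by omega)).2.1, Nat.add_mod_left, Nat.mod_eq_of_lt (by omega)]
    · obtain ⟨j, rfl⟩ := Nat.exists_eq_add_of_le (not_lt.1 h1)
      obtain ⟨j, rfl⟩ := Nat.exists_eq_add_of_le (show n ≤ j by omega)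
      rw [(hA j (by omega)).2.2, Nat.add_mod_left, Nat.add_mod_left, Nat.mod_eq_of_lt (by omega)]

theorem ends_build {d q m : ℕ} (h : Base n M) (h4 : M.reg 4 = d) (h5 : M.reg 5 = q)
    (h6 : M.reg 6 = m) (hd : d < n) (hq : q < n) (hm : m < n) : Ends y build M fun M' t qs =>
      qs = [] ∧ t ≤ 100 * (n + 1) ∧ Frame [3] [2] M M' ∧
        ∀ i : Fin n, M'.arr 2 i = hybrid n d q m i := by
  simp only [build, ends_seq, ends_setReg]
  refine (ends_loop (fun M' qs => qs = [] ∧ Frame [3] [2] M M' ∧ M'.reg 3 ≤ n ∧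
    ∀ t < M'.reg 3, M'.arr 2 ((q + d + 1 + t) % n) = (q + slot m t) % n)
    (fun M' => n - M'.reg 3) 70 ?_ ?_).mono ?_
  · exact ⟨rfl, Frame.refl.setReg (by simp), by simp [Memory.setReg_reg, Expr.eval],
      by simp [Memory.setReg_reg, Expr.eval]⟩
  · rintro M₁ qs ⟨rfl, hf, h3, hA⟩ he
    have h0 : M₁.reg 0 = n := by rw [hf.1 0 (by simp), h.1]
    have h4 : M₁.reg 4 = d := by rw [hf.1 4 (by simp), h4]
    have h5 : M₁.reg 5 = q := by rw [hf.1 5 (by simp), h5]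
    have h6 : M₁.reg 6 = m := by rw [hf.1 6 (by simp), h6]
    have hW : ∀ i < 3 * n, M₁.arr 4 i = i % n := by rw [hf.2 4 (by simp)]; exact h.2
    simp only [Expr.eval, h0] at he
    -- The index is at most `3 * n - 2`; this is why the table has `3 * n` entries.
    have e1 : M₁.arr 4 (q + (d + (1 + M₁.reg 3))) = (q + d + 1 + M₁.reg 3) % n := by
      rw [hW _ (by omega)]; congr 1; omega
    have e2 := hW (q + M₁.reg 3) (by omega)
    have e3 := hW (q + (M₁.reg 3 + 1)) (by omega)
    -- All three branches amount to writing one colour at the current position, so the invariant is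
    -- restored once for all.
    have key : ∀ M₂ : Memory, ∀ v, v = (q + slot m (M₁.reg 3)) % n → Frame [3] [2] M M₂ →
        M₂.reg 3 = M₁.reg 3 + 1 → (∀ l, M₂.arr 2 l =
          if l = (q + d + 1 + M₁.reg 3) % n then v else M₁.arr 2 l) →
        (([] : List (Equiv.Perm (Fin n))) = [] ∧ Frame [3] [2] M M₂ ∧ M₂.reg 3 ≤ n ∧
          ∀ t < M₂.reg 3, M₂.arr 2 ((q + d + 1 + t) % n) = (q + slot m t) % n) ∧
          n - M₂.reg 3 < n - M₁.reg 3 := by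
      rintro M₂ v rfl hf₂ hr₂ hA₂
      refine ⟨⟨rfl, hf₂, by omega, fun t ht => ?_⟩, by omega⟩
      rw [hA₂]
      obtain ht | rfl := Nat.lt_succ_iff_lt_or_eq.1 (hr₂ ▸ ht)
      · rw [if_neg, hA t ht]
        intro h'
        have := add_mod_cancel (by omega) (by omega) h'
        omega
      · simp
    simp only [ends_setReg, ends_setArr, ends_seq, ends_ite, ends_skip, Expr.eval, Expr.cost,
      Memory.setArr_reg, Memory.setArr_arr, Nat.reduceEqDiff, false_and, if_false, h4, h5, h6,
      e1, e2, e3]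
    split_ifs with h1 h2
    · refine ⟨by norm_num, key _ q ?_
          (((hf.setArr (by simp)).setArr (by simp)).setReg (by simp)) (by simp) ?_⟩
      · rw [slot, if_neg (by omega), if_neg (by omega), add_zero, Nat.mod_eq_of_lt hq]
      · intro l
        simp only [Memory.setReg_arr, Memory.setArr_arr, true_and]
        split_ifs <;> rfl
    · refine ⟨by norm_num, key _ ((q + M₁.reg 3) % n) ?_
          ((hf.setArr (by simp)).setReg (by simp)) (by simp) ?_⟩
      · rw [slot, if_neg (by omega), if_pos (by omega)]
      · intro l
        simp only [Memory.setReg_arr, Memory.setArr_arr, true_and]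
    · refine ⟨by norm_num, key _ ((q + (M₁.reg 3 + 1)) % n) ?_
          (((hf.setArr (by simp)).setArr (by simp)).setReg (by simp)) (by simp) ?_⟩
      · rw [slot, if_pos (by omega)]
      · intro l
        simp only [Memory.setReg_arr, Memory.setArr_arr, true_and]
        split_ifs <;> rfl
  · rintro M₁ t qs ⟨⟨rfl, hf, h3, hA⟩, he, ht⟩
    have h0 : M₁.reg 0 = n := by rw [hf.1 0 (by simp), h.1]
    simp only [Expr.eval, h0] at he
    simp [Expr.cost, Memory.setReg_reg, Expr.eval] at ht
    refine ⟨rfl, by simp [Expr.cost]; omega, hf, fun i => ?_⟩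
    obtain ⟨t, ht, hi⟩ := exists_add_mod (q + d + 1) i i.2
    rw [hybrid_apply hm ht hi.symm, ← hi, hA t (by omega)]

theorem ends_ask {d q m : ℕ} (h : Base n M) (h4 : M.reg 4 = d) (h5 : M.reg 5 = q)
    (h6 : M.reg 6 = m) (hd : d < n) (hq : q < n) (hm : m < n) : Ends y ask M fun M' t qs =>
      qs = [hybrid n d q m] ∧ t ≤ 200 * (n + 1) ∧ Frame [2, 3] [2] M M' ∧
        M'.reg 2 = black (hybrid n d q m) y ∧ ∀ i : Fin n, M'.arr 2 i = hybrid n d q m i := by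
  rw [ask, ends_seq]
  refine (ends_build h h4 h5 h6 hd hq hm).mono ?_
  rintro M₁ t _ ⟨rfl, ht, hf, hx⟩
  refine ends_query (hybrid n d q m) hx ⟨rfl, by omega, ?_, by simp [Memory.setReg_reg], hx⟩
  exact (Frame.refl.trans hf (by simp) (by simp)).setReg (by simp)

theorem ends_find (h : Base n M) : Ends y find M fun M' t qs =>
    qs = [] ∧ t ≤ 100 * (n + 1) ∧ Frame [1, 4] [] M M' ∧
      ((M'.reg 4 < n ∧ M.arr 1 (M'.reg 4) ≠ 0 ∧ M.arr 1 ((M'.reg 4 + 1) % n) = 0) ∨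
        (M'.reg 4 = n ∧ ∀ d < n, M.arr 1 d ≠ 0 → M.arr 1 ((d + 1) % n) ≠ 0)) := by
  simp only [find, ends_seq, ends_setReg]
  refine (ends_loop (fun M' qs => qs = [] ∧ Frame [1, 4] [] M M' ∧ M'.reg 1 ≤ n ∧
    ((M'.reg 4 < n ∧ M.arr 1 (M'.reg 4) ≠ 0 ∧ M.arr 1 ((M'.reg 4 + 1) % n) = 0) ∨
      (M'.reg 4 = n ∧ ∀ d < M'.reg 1, M.arr 1 d ≠ 0 → M.arr 1 ((d + 1) % n) ≠ 0)))
    (fun M' => n - M'.reg 1) 40 ?_ ?_).mono ?_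
  · exact ⟨rfl, (Frame.refl.setReg (by simp)).setReg (by simp),
      by simp [Memory.setReg_reg, Expr.eval], by simp [Memory.setReg_reg, Expr.eval, h.1]⟩
  · rintro M₁ qs ⟨rfl, hf, h3, hA⟩ he
    have h0 : M₁.reg 0 = n := by rw [hf.1 0 (by simp), h.1]
    have h1 : M₁.arr 1 = M.arr 1 := hf.2 1 (by simp)
    simp only [Expr.eval, h0] at he
    have e1 : M₁.arr 4 (M₁.reg 1 + 1) = (M₁.reg 1 + 1) % n := by
      rw [hf.2 4 (by simp), h.2 _ (by omega)]
    have key : ∀ {P : ℕ → Prop}, (∀ d < M₁.reg 1, P d) → P (M₁.reg 1) →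
        ∀ d < M₁.reg 1 + 1, P d := fun h1 h2 d hd =>
      (Nat.lt_succ_iff_lt_or_eq.1 hd).elim (h1 d) (fun h => h ▸ h2)
    simp only [ends_setReg, ends_seq, ends_ite, ends_skip, Expr.eval, Expr.cost,
      Memory.setReg_reg, OfNat.one_ne_ofNat, OfNat.ofNat_ne_one, if_false,
      if_true, e1, h1]
    split_ifs with h2 h3
    · refine ⟨by norm_num, ⟨by simp, hf.setReg (by simp), by omega, ?_⟩, by omega⟩
      exact hA.imp_right fun ⟨a, b⟩ => ⟨a, key b fun h => absurd h2 h⟩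
    · refine ⟨by norm_num, ⟨by simp, (hf.setReg (by simp)).setReg (by simp), by omega, ?_⟩,
        by omega⟩
      exact Or.inl ⟨by omega, h2, h3⟩
    · refine ⟨by norm_num, ⟨by simp, hf.setReg (by simp), by omega, ?_⟩, by omega⟩
      exact hA.imp_right fun ⟨a, b⟩ => ⟨a, key b fun _ => h3⟩
  · rintro M₁ t qs ⟨⟨rfl, hf, h3, hA⟩, he, ht⟩
    have h0 : M₁.reg 0 = n := by rw [hf.1 0 (by simp), h.1]
    simp only [Expr.eval, h0] at he
    simp [Expr.cost, Memory.setReg_reg, Expr.eval] at ht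
    rw [show M₁.reg 1 = n by omega] at hA
    exact ⟨rfl, by simp [Expr.cost]; omega, hf, hA⟩

theorem ends_record (h : Known y S M) {i : Fin n} (hi : i ∉ S) (h10 : M.reg 10 = i)
    (h11 : M.reg 11 = y i) : Ends y record M fun M' t qs =>
      qs = [] ∧ t ≤ 50 ∧ Frame [12] [0, 1, 3] M M' ∧ Known y (insert i S) M' := by
  have h0 := h.base.1
  have e : M.arr 4 (n + i - y i) = diag y i := h.base.2 _ (by omega)
  simp only [record, ends_setReg, ends_setArr, ends_seq, Expr.eval, Expr.cost,
    Memory.setArr_reg, Memory.setArr_arr, h0, h10, h11]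
  refine ⟨rfl, by norm_num, (((Frame.refl.setArr (by simp)).setArr (by simp)).setArr
    (by simp)).setReg (by simp), ?_⟩
  have hc : 0 < Mastermind.count y S (diag y i) := (count_pos_iff y).2 ⟨i, hi, rfl⟩
  constructor
  · simpa [Base, Memory.setReg_reg, Memory.setArr_reg, Memory.setReg_arr, Memory.setArr_arr]
      using h.base
  · have h1 := h.rest
    have h2 : (insert i S).card ≤ n := by simpa using (insert i S).card_le_univ
    rw [Finset.card_insert_of_notMem hi] at h2 ⊢
    simp [Memory.setReg_reg]
    omega
  · intro j hj
    by_cases hji : j = i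
    · simp [Memory.setReg_arr, Memory.setArr_arr, hji]
    · simpa [Memory.setReg_arr, Memory.setArr_arr, hji, Fin.val_inj] using
        h.peg j ((Finset.mem_insert.1 hj).resolve_left hji)
  · intro j
    by_cases hji : j = i
    · simp [Memory.setReg_arr, Memory.setArr_arr, hji]
    · simpa [Memory.setReg_arr, Memory.setArr_arr, hji, Fin.val_inj] using h.mark j
  · intro d hd
    rw [count_insert y hi]
    simp [Memory.setReg_arr, Memory.setArr_arr, e, h.count _ hd, h.count _ (diag_lt y i)]
    split_ifs with h <;> simp [h]

end

/-! ### The initial shifts and the first peg -/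

/-- Guessing all shifts but the last one, and computing the answer for the last one. -/
def shifts : Program :=
  .setArr 1 (.sub (.reg 0) (.lit 1)) (.reg 0) ;;
  .setReg 12 (.reg 0) ;;
  .setReg 5 (.lit 0) ;;
  .setReg 6 (.sub (.reg 0) (.lit 1)) ;;
  .setReg 4 (.lit 0) ;;
  .loop (.sub (.reg 6) (.reg 4))
    (ask ;;
      .setArr 1 (.reg 4) (.reg 2) ;;
      .setArr 1 (.reg 6) (.sub (.arr 1 (.reg 6)) (.reg 2)) ;;
      .setReg 4 (.add (.reg 4) (.lit 1)))

/-- Finding the colour `0` if the diagonal `reg 4`, but not the next one, has an unknown peg. -/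
def scanHybrids : Program :=
  .setReg 5 (.lit 0) ;;
  .setReg 6 (.lit 1) ;;
  .setReg 7 (.lit 0) ;;
  .setReg 10 (.sub (.reg 0) (.lit 1)) ;;
  .loop (.sub (.reg 0) (.reg 6))
    (ask ;;
      .ite (.sub (.reg 7) (.reg 2)) (.setReg 10 (.sub (.reg 6) (.lit 1))) .skip ;;
      .setReg 7 (.reg 2) ;;
      .setReg 6 (.add (.reg 6) (.lit 1))) ;;
  .setReg 10 (.arr 4 (.add (.reg 4) (.add (.lit 1) (.reg 10)))) ;;
  .setReg 11 (.lit 0)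

/-- Finding the unique correct peg of the identity. -/
def scanSwaps : Program :=
  .setReg 4 (.lit 0) ;;
  .setReg 5 (.lit 0) ;;
  .setReg 6 (.sub (.reg 0) (.lit 1)) ;;
  .setReg 7 (.lit 0) ;;
  .setReg 10 (.lit 0) ;;
  .setReg 1 (.lit 1) ;;
  .loop (.sub (.reg 0) (.reg 1))
    (build ;;
      .setArr 2 (.lit 0) (.reg 1) ;;
      .setArr 2 (.reg 1) (.lit 0) ;;
      .query 2 2 ;;
      .ite (.reg 2) .skip (.setReg 7 (.add (.reg 7) (.lit 1)) ;; .setReg 10 (.reg 1)) ;;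
      .setReg 1 (.add (.reg 1) (.lit 1))) ;;
  .ite (.add (.sub (.reg 7) (.lit 1)) (.sub (.lit 1) (.reg 7))) (.setReg 10 (.lit 0)) .skip ;;
  .setReg 11 (.reg 10)

/-- Finding and recording a first peg, whose colour is put into register `5`. -/
def first : Program :=
  find ;;
  .ite (.sub (.reg 0) (.reg 4)) scanHybrids scanSwaps ;;
  .setReg 5 (.reg 11) ;;
  record

section

variable {n : ℕ} {y : Equiv.Perm (Fin n)} {M M' : Memory} {S : Finset (Fin n)}

theorem ends_shifts (h : Base n M) (hn : 0 < n) (h3 : ∀ i, M.arr 3 i = 0) :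
    Ends y shifts M fun M' t qs => qs = (List.range (n - 1)).map (cyclicShift n) ∧
      t ≤ 1000 * (n + 1) ^ 2 ∧ Known y ∅ M' := by
  have h0 := h.1
  simp only [shifts, ends_seq, ends_setReg, ends_setArr, Expr.eval, Memory.setArr_reg,
    Memory.setReg_reg, OfNat.zero_ne_ofNat, if_false, h0]
  set M₀ := (((((M.setArr 1 (n - 1) n).setReg 12 n).setReg 5 0).setReg 6 (n - 1)).setReg 4 0)
    with hM₀
  refine (ends_loop (fun M' qs => qs = (List.range (M'.reg 4)).map (cyclicShift n) ∧
    Frame [2, 3, 4] [1, 2] M₀ M' ∧ M'.reg 4 ≤ n - 1 ∧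
    (∀ d < M'.reg 4, M'.arr 1 d = count y ∅ d) ∧
    M'.arr 1 (n - 1) + ∑ d ∈ Finset.range (M'.reg 4), count y ∅ d = n)
    (fun M' => n - 1 - M'.reg 4) (250 * (n + 1)) ?_ ?_).mono ?_
  · exact ⟨by simp [hM₀], Frame.refl, by simp [hM₀], by simp [hM₀], by simp [hM₀]⟩
  · rintro M₁ qs ⟨rfl, hf, h4, hA, hs⟩ he
    have h0 : M₁.reg 0 = n := by rw [hf.1 0 (by simp)]; simp [hM₀, h.1]
    have h5 : M₁.reg 5 = 0 := by rw [hf.1 5 (by simp)]; simp [hM₀]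
    have h6 : M₁.reg 6 = n - 1 := by rw [hf.1 6 (by simp)]; simp [hM₀]
    have hb : Base n M₁ := Base.frame (M := M₀)
      (by simpa [Base, hM₀] using h) hf (by simp) (by simp)
    simp only [Expr.eval, h6] at he
    rw [ends_seq]
    refine (ends_ask hb rfl h5 h6 (by omega) hn (by omega)).mono ?_
    rintro M₂ t₂ _ ⟨rfl, ht₂, hf₂, hr₂, -⟩
    rw [hybrid_eq_cyclicShift hn] at hr₂ ⊢
    rw [black_cyclicShift y (by omega)] at hr₂
    have g4 : M₂.reg 4 = M₁.reg 4 := hf₂.1 4 (by simp)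
    have g6 : M₂.reg 6 = n - 1 := by rw [hf₂.1 6 (by simp), h6]
    have g1 : M₂.arr 1 = M₁.arr 1 := hf₂.2 1 (by simp)
    -- Entry `n - 1` starts at `n` and loses each answer. It never falls below the next answer, so
    -- the truncated subtraction is exact.
    have hle : count y ∅ (M₁.reg 4) ≤ M₁.arr 1 (n - 1) := by
      have := Finset.sum_le_sum_of_subset (f := count y ∅)
        (Finset.range_mono (show M₁.reg 4 + 1 ≤ n by omega))
      rw [sum_count_empty, Finset.sum_range_succ] at this
      omega
    simp only [ends_seq, ends_setReg, ends_setArr, Expr.eval, Expr.cost, Memory.setArr_reg,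
      Memory.setArr_arr, g4, g6, g1, hr₂]
    refine ⟨by omega, ⟨?_, ?_, ?_, ?_, ?_⟩, ?_⟩
    · simp [List.range_succ]
    · exact (((hf.trans hf₂ (by simp) (by simp)).setArr (by simp)).setArr (by simp)).setReg (by simp)
    · simp; omega
    · simp only [Memory.setReg_reg, if_true, Memory.setReg_arr, Memory.setArr_arr, true_and, g1]
      intro d hd
      obtain hd | rfl := Nat.lt_succ_iff_lt_or_eq.1 hd
      · rw [if_neg (by omega), if_neg (by omega), hA d hd]
      · rw [if_neg (by omega), if_pos rfl]
    · simp only [Memory.setReg_reg, if_true, Memory.setReg_arr, Memory.setArr_arr, true_and, g1]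
      rw [if_neg (by omega), Finset.sum_range_succ]
      omega
    · simp; omega
  · rintro M₁ t qs ⟨⟨rfl, hf, h4, hA, hs⟩, he, ht⟩
    have h6 : M₁.reg 6 = n - 1 := by rw [hf.1 6 (by simp)]; simp [hM₀]
    simp only [Expr.eval, h6] at he
    rw [show M₁.reg 4 = n - 1 by omega] at hA hs ⊢
    refine ⟨rfl, ?_, ?_⟩
    · have : M₀.reg 4 = 0 := by simp [hM₀]
      simp only [this, Expr.cost] at ht ⊢
      rw [show n - 1 - 0 + 1 = n by omega] at ht
      nlinarith
    · constructor
      · exact Base.frame (M := M₀) (by simpa [Base, hM₀] using h) hf (by simp) (by simp)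
      · rw [hf.1 12 (by simp)]; simp [hM₀]
      · simp
      · intro i
        rw [hf.2 3 (by simp)]
        simp [hM₀, h3]
      · intro d hd
        by_cases hd' : d < n - 1
        · exact hA d hd'
        · obtain rfl : d = n - 1 := by omega
          have := sum_count_empty y
          nth_rw 1 [show n = n - 1 + 1 by omega] at this
          rw [Finset.sum_range_succ] at this
          omega

theorem ends_scanHybrids (h : Base n M) (hd : M.reg 4 < n)
    (hz : count y ∅ ((M.reg 4 + 1) % n) = 0) :
    Ends y scanHybrids M fun M' t qs => qs.length ≤ n - 1 ∧ t ≤ 1000 * (n + 1) ^ 2 ∧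
      Frame [2, 3, 5, 6, 7, 10, 11] [2] M M' ∧ ∃ i : Fin n, M'.reg 10 = i ∧ M'.reg 11 = y i := by
  have h0 := h.1
  have hn : 0 < n := by omega
  simp only [scanHybrids, ends_seq, ends_setReg, Expr.eval,
    Memory.setReg_reg, OfNat.zero_ne_ofNat, if_false, h0]
  set M₀ := (((M.setReg 5 0).setReg 6 1).setReg 7 0).setReg 10 (n - 1)
    with hM₀
  set d := M.reg 4 with hd'
  have hf₀ : Frame [2, 3, 5, 6, 7, 10, 11] [2] M M₀ :=
    (((Frame.refl.setReg (by simp)).setReg (by simp)).setReg (by simp)).setReg (by simp)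
  refine (ends_loop (fun M' qs => qs.length + 1 = M'.reg 6 ∧
    Frame [2, 3, 6, 7, 10] [2] M₀ M' ∧ M'.reg 6 ≤ n ∧
    M'.reg 7 = black (hybrid n d 0 (M'.reg 6 - 1)) y ∧
    -- Either the offset of colour `0` has been found, or it is none of those tested. The default `n
    -- - 1` is the one offset that is never tested, hence correct if no drop occurs. The answer for
    -- cut `0` is known to be `0`, so the scan starts at cut `1`.
    ((M'.reg 10 < n ∧ ∀ i : Fin n, (i : ℕ) = (0 + d + 1 + M'.reg 10) % n → (y i : ℕ) = 0) ∨
    (M'.reg 10 = n - 1 ∧ ∀ s < M'.reg 6 - 1, ∀ i : Fin n, (i : ℕ) = (0 + d + 1 + s) % n →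
      (y i : ℕ) ≠ 0)))
    (fun M' => n - M'.reg 6) (250 * (n + 1)) ?_ ?_).mono ?_
  · exact ⟨by simp [hM₀], Frame.refl, by simp [hM₀]; omega,
      by simp [hM₀, black_hybrid_zero y hd hn hz], by simp [hM₀]⟩
  · rintro M₁ qs ⟨hl, hf, h6, h7, hor⟩ he
    have h0 : M₁.reg 0 = n := by rw [hf.1 0 (by simp)]; simp [hM₀, h.1]
    have h4 : M₁.reg 4 = d := by rw [hf.1 4 (by simp)]; simp [hM₀, hd']
    have h5 : M₁.reg 5 = 0 := by rw [hf.1 5 (by simp)]; simp [hM₀]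
    have hb : Base n M₁ := (h.frame hf₀ (by simp) (by simp)).frame hf (by simp) (by simp)
    simp only [Expr.eval, h0] at he
    rw [ends_seq]
    refine (ends_ask hb h4 h5 rfl (by omega) hn (by omega)).mono ?_
    rintro M₂ t₂ _ ⟨rfl, ht₂, hf₂, hr₂, -⟩
    have g6 : M₂.reg 6 = M₁.reg 6 := hf₂.1 6 (by simp)
    have g7 : M₂.reg 7 = M₁.reg 7 := hf₂.1 7 (by simp)
    have g10 : M₂.reg 10 = M₁.reg 10 := hf₂.1 10 (by simp)
    obtain ⟨m, hm⟩ : ∃ m, M₁.reg 6 = m + 1 := ⟨_, hl.symm⟩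
    rw [hm] at h6 h7 hr₂ hl hor he g6
    simp only [add_tsub_cancel_right] at h7 hor
    have key : ∀ i : Fin n, (i : ℕ) = (0 + d + 1 + m) % n → (M₂.reg 2 < M₁.reg 7 ↔ (y i : ℕ) = 0) :=
      fun i hi => by
        rw [hr₂, h7]
        exact black_hybrid_succ_lt_iff y hd hn (by omega) hz hi
    have hff := hf.trans hf₂ (by simp) (by simp)
    simp only [ends_seq, ends_setReg, ends_ite, ends_skip, Expr.eval, Expr.cost, Memory.setReg_reg,
      Nat.reduceEqDiff, if_false, hm, g6, g7]
    split_ifs with hc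
    · refine ⟨by omega, ⟨by simp [hl], (hff.setReg (by simp)).setReg (by simp), by omega,
        by simpa using hr₂, ?_⟩, by omega⟩
      simp only [g10, add_tsub_cancel_right]
      refine hor.imp_right fun ⟨h1, h2⟩ => ⟨h1, fun s hs i hi => ?_⟩
      obtain hs | rfl := Nat.lt_succ_iff_lt_or_eq.1 hs
      · exact h2 s hs i hi
      · exact fun h' => by have := (key i hi).2 h'; omega
    · refine ⟨by omega, ⟨by simp [hl], ((hff.setReg (by simp)).setReg (by simp)).setReg (by simp),
        by omega, by simpa using hr₂, Or.inl ?_⟩, by omega⟩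
      simp only [add_tsub_cancel_right]
      exact ⟨by omega, fun i hi => (key i hi).1 (by omega)⟩
  · rintro M₁ t qs ⟨⟨hl, hf, h6, h7, hor⟩, he, ht⟩
    have h0 : M₁.reg 0 = n := by rw [hf.1 0 (by simp)]; simp [hM₀, h.1]
    have h4 : M₁.reg 4 = d := by rw [hf.1 4 (by simp)]; simp [hM₀, hd']
    have hb : Base n M₁ := (h.frame hf₀ (by simp) (by simp)).frame hf (by simp) (by simp)
    simp only [Expr.eval, h0] at he
    rw [show M₁.reg 6 = n by omega] at hor hl
    have h10 : M₁.reg 10 < n := by omega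
    simp only [Nat.reduceEqDiff, if_false, if_true, h4, Expr.cost]
    rw [hb.2 _ (by omega)]
    refine ⟨by simp; omega, ?_, ?_, ⟨(d + (1 + M₁.reg 10)) % n, Nat.mod_lt _ hn⟩, by simp, ?_⟩
    · have : M₀.reg 6 = 1 := by simp [hM₀]
      simp only [this, Expr.cost] at ht ⊢
      rw [show n - 1 + 1 = n by omega] at ht
      nlinarith
    · exact ((hf₀.trans hf (by simp) (by simp)).setReg (by simp)).setReg (by simp)
    · obtain ⟨-, h1⟩ | ⟨h1, h2⟩ := hor
      · exact (h1 _ (by simp only []; congr 1; omega)).symm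
      · by_contra hne
        obtain ⟨t, ht, hi⟩ := exists_add_mod (0 + d + 1) _ (y.symm ⟨0, hn⟩).2
        by_cases htn : t < n - 1
        · exact h2 t htn _ hi.symm (by simp)
        · obtain rfl : t = n - 1 := by omega
          apply hne
          have : (⟨(d + (1 + M₁.reg 10)) % n, Nat.mod_lt _ hn⟩ : Fin n) = y.symm ⟨0, hn⟩ := by
            ext
            rw [← hi, h1]
            simp only []
            congr 1; omega
          rw [this]; simp

/-- For `n = 2` the single swap could not tell the two positions apart; this case does not arise. -/
theorem count_empty_zero_ne_one (y : Equiv.Perm (Fin 2)) : count y ∅ 0 ≠ 1 := by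
  revert y; decide

theorem ends_scanSwaps (h : Base n M) (hn : 0 < n) (h1 : count y ∅ 0 = 1) :
    Ends y scanSwaps M fun M' t qs => qs.length ≤ n - 1 ∧ t ≤ 1000 * (n + 1) ^ 2 ∧
      Frame [1, 2, 3, 4, 5, 6, 7, 10, 11] [2] M M' ∧
      ∃ i : Fin n, M'.reg 10 = i ∧ M'.reg 11 = y i := by
  have h0 := h.1
  have hn2 : n ≠ 2 := by
    rintro rfl
    exact count_empty_zero_ne_one y h1
  obtain ⟨e, -, he₀⟩ := (count_pos_iff y).1 (h1.symm ▸ Nat.one_pos)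
  have he : y e = e := by
    have := add_diag_mod y e
    rw [he₀, add_zero, Nat.mod_eq_of_lt (y e).2] at this
    exact Fin.ext this
  simp only [scanSwaps, ends_seq, ends_setReg, Expr.eval,
    Memory.setReg_reg, OfNat.zero_ne_ofNat, if_false, h0]
  set M₀ := (((((M.setReg 4 0).setReg 5 0).setReg 6 (n - 1)).setReg 7 0).setReg 10 0).setReg 1 1
    with hM₀
  have hf₀ : Frame [1, 2, 3, 4, 5, 6, 7, 10, 11] [2] M M₀ :=
    (((((Frame.refl.setReg (by simp)).setReg (by simp)).setReg (by simp)).setReg (by simp)).setReg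
      (by simp)).setReg (by simp)
  refine (ends_loop (fun M' qs => qs.length + 1 = M'.reg 1 ∧
    Frame [1, 2, 3, 7, 10] [2] M₀ M' ∧ M'.reg 1 ≤ n ∧
    -- Register `7` counts the swaps answered by zero: all `n - 1` of them if `e = 0`, and exactly
    -- one otherwise. As `n ≠ 2`, the final count decides.
    ((e : ℕ) = 0 → M'.reg 7 + 1 = M'.reg 1) ∧
    ((e : ℕ) ≠ 0 → M'.reg 7 = (if (e : ℕ) < M'.reg 1 then 1 else 0) ∧
      ((e : ℕ) < M'.reg 1 → M'.reg 10 = e)))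
    (fun M' => n - M'.reg 1) (250 * (n + 1)) ?_ ?_).mono ?_
  · refine ⟨by simp [hM₀], Frame.refl, by simp [hM₀]; omega, by simp [hM₀], fun h => ?_⟩
    simp [hM₀]
    omega
  · rintro M₁ qs ⟨hl, hf, h6, h7, hor⟩ hgt
    have h0 : M₁.reg 0 = n := by rw [hf.1 0 (by simp)]; simp [hM₀, h.1]
    have h4 : M₁.reg 4 = 0 := by rw [hf.1 4 (by simp)]; simp [hM₀]
    have h5 : M₁.reg 5 = 0 := by rw [hf.1 5 (by simp)]; simp [hM₀]
    have h6 : M₁.reg 6 = n - 1 := by rw [hf.1 6 (by simp)]; simp [hM₀]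
    have hb : Base n M₁ := (h.frame hf₀ (by simp) (by simp)).frame hf (by simp) (by simp)
    simp only [Expr.eval, h0] at hgt
    rw [ends_seq]
    refine (ends_build hb h4 h5 h6 hn hn (by omega)).mono ?_
    rintro M₂ t₂ _ ⟨rfl, ht₂, hf₂, hA₂⟩
    rw [hybrid_eq_cyclicShift hn] at hA₂
    have g1 : M₂.reg 1 = M₁.reg 1 := hf₂.1 1 (by simp)
    have g7 : M₂.reg 7 = M₁.reg 7 := hf₂.1 7 (by simp)
    have g10 : M₂.reg 10 = M₁.reg 10 := hf₂.1 10 (by simp)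
    have hff := hf.trans hf₂ (by simp) (by simp)
    rw [ends_seq, ends_setArr, ends_seq, ends_setArr, ends_seq]
    have hk : M₁.reg 1 < n := by omega
    have hbl := black_swap_eq_zero_iff y h1 he (k := ⟨0, hn⟩) (l := ⟨M₁.reg 1, hk⟩)
      (by simp [Fin.ext_iff]; omega)
    refine ends_query (Equiv.swap ⟨0, hn⟩ ⟨M₁.reg 1, hk⟩) (fun i => ?_) ?_
    · simp only [Memory.setArr_arr, Expr.eval, Memory.setArr_reg, g1, true_and, hA₂]
      rw [Equiv.swap_apply_def]
      simp only [Fin.ext_iff]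
      have : (cyclicShift n 0 i : ℕ) = i := by simp [cyclicShift]
      split_ifs <;> simp_all
    · simp only [ends_seq, ends_setReg, ends_ite, ends_skip, Expr.eval, Expr.cost,
        Memory.setReg_reg, Memory.setArr_reg, Nat.reduceEqDiff, OfNat.one_ne_ofNat, if_false,
        if_true, g1, g7]
      simp only [Fin.ext_iff] at hbl
      by_cases hc : black (Equiv.swap ⟨0, hn⟩ ⟨M₁.reg 1, hk⟩) y = 0
      · rw [if_pos hc]
        rw [hbl] at hc
        refine ⟨by omega, ⟨by simp [hl], ((((((hff.setArr (by simp)).setArr (by simp)).setReg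
          (by simp))).setReg (by simp)).setReg (by simp)).setReg (by simp), by omega, ?_, ?_⟩,
          by omega⟩
        · omega
        · simp
          intro hne
          have : (e : ℕ) = M₁.reg 1 := hc.resolve_left hne
          have := (hor hne).1
          rw [if_neg (by omega)] at this
          simp [*]
      · rw [if_neg hc]
        rw [hbl] at hc
        refine ⟨by omega, ⟨by simp [hl], ((((hff.setArr (by simp)).setArr (by simp)).setReg
          (by simp))).setReg (by simp), by omega, ?_, ?_⟩,
          by omega⟩
        · intro h'; exact absurd (Or.inl h') hc
        · simp [g10]
          intro hne
          obtain ⟨h8, h9⟩ := hor hne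
          push Not at hc
          refine ⟨?_, fun hle => h9 (by omega)⟩
          rw [h8]
          congr 1
          rw [eq_iff_iff]
          omega
  · rintro M₁ t qs ⟨⟨hl, hf, h6, h7, hor⟩, hge, ht⟩
    have h0 : M₁.reg 0 = n := by rw [hf.1 0 (by simp)]; simp [hM₀, h.1]
    simp only [Expr.eval, h0] at hge
    rw [show M₁.reg 1 = n by omega] at hor h7 hl
    have hff := hf₀.trans hf (by simp) (by simp)
    simp only [e.2, if_true, forall_const] at hor
    have ht' : t ≤ n * (250 * (n + 1) + 5) := by
      have : M₀.reg 1 = 1 := by simp [hM₀]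
      simp only [this, Expr.cost] at ht ⊢
      rw [show n - 1 + 1 = n by omega] at ht
      nlinarith
    simp only [ends_setReg, ends_ite, ends_skip, Expr.eval, Expr.cost, Memory.setReg_reg,
      Nat.reduceEqDiff, if_false, if_true]
    split_ifs with hc
    · refine ⟨by simp; omega, by nlinarith, hff.setReg (by simp), e, ?_⟩
      have : (e : ℕ) ≠ 0 := by omega
      simp [(hor this).2, he]
    · refine ⟨by simp; omega, by nlinarith, (hff.setReg (by simp)).setReg (by simp), e, ?_⟩
      have : (e : ℕ) = 0 := by
        by_contra hne
        have := (hor hne).1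
        omega
      simp [he, this]

theorem ends_first (h : Known y ∅ M) (hn : 0 < n) :
    Ends y first M fun M' t qs => qs.length ≤ n - 1 ∧ t ≤ 3000 * (n + 1) ^ 2 ∧
      ∃ i, Known y {i} M' ∧ M'.reg 5 = y i ∧ ∃ d < n, count y {i} d = 0 := by
  rw [first, ends_seq]
  refine (ends_find h.base).mono ?_
  rintro M₁ t₁ _ ⟨rfl, ht₁, hf₁, hd⟩
  have hk₁ := h.frame hf₁ (by simp) (by simp)
  have h0 := hk₁.base.1
  have key : Ends y (.ite (.sub (.reg 0) (.reg 4)) scanHybrids scanSwaps) M₁ fun M' t qs =>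
      qs.length ≤ n - 1 ∧ t ≤ 1000 * (n + 1) ^ 2 + 10 ∧
      Frame [1, 2, 3, 4, 5, 6, 7, 10, 11] [2] M₁ M' ∧
      ∃ i : Fin n, M'.reg 10 = i ∧ M'.reg 11 = y i ∧ ∃ d < n, count y {i} d = 0 := by
    simp only [ends_ite, Expr.eval, h0, Expr.cost]
    have hle : ∀ i d, count y {i} d = if d = diag y i then count y ∅ d - 1 else count y ∅ d :=
      fun i d => count_insert y (Finset.notMem_empty i) d
    rcases hd with ⟨h4, h5, h6⟩ | ⟨h4, h5⟩
    · rw [if_neg (by omega)]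
      rw [h.count _ (Nat.mod_lt _ hn)] at h6
      refine (ends_scanHybrids hk₁.base h4 h6).mono ?_
      rintro M₂ t₂ qs ⟨h1, h2, h3, i, hi, hi'⟩
      refine ⟨h1, by omega, Frame.refl.trans h3 (by simp) (by simp), i, hi, hi',
        (M₁.reg 4 + 1) % n,
        Nat.mod_lt _ hn, ?_⟩
      rw [hle, h6]
      simp
    · rw [if_pos (by omega)]
      have hall : ∀ d < n, count y ∅ d ≠ 0 := by
        intro d hd hz
        obtain ⟨a, ha, ha', ha''⟩ := exists_pos_zero_succ (count y ∅)
          ⟨diag y ⟨0, hn⟩, diag_lt _ _, ((count_pos_iff y).2 ⟨⟨0, hn⟩, by simp, rfl⟩).ne'⟩ ⟨d, hd, hz⟩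
        have := h5 a ha (by rwa [h.count a ha])
        rw [h.count _ (Nat.mod_lt _ hn)] at this
        exact this ha''
      refine (ends_scanSwaps hk₁.base hn (count_empty_eq_one y hall hn)).mono ?_
      rintro M₂ t₂ qs ⟨h1, h2, h3, i, hi, hi'⟩
      refine ⟨h1, by omega, h3, i, hi, hi', _, diag_lt y i, ?_⟩
      -- The recorded peg was alone on its diagonal, which therefore becomes the empty one.
      rw [hle, if_pos rfl, count_empty_eq_one y hall (diag_lt y i)]
  rw [ends_seq]
  refine key.mono ?_
  rintro M₂ t₂ qs₂ ⟨hl, ht₂, hf₂, i, hi, hi', hd⟩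
  rw [ends_seq, ends_setReg]
  refine (ends_record (S := ∅) (i := i) (hk₁.frame (hf₂.setReg (k := 5) (by simp)) (by simp)
    (by simp)) (by simp) (by simpa using hi) (by simpa using hi')).mono ?_
  rintro M₃ t₃ _ ⟨rfl, ht₃, hf₃, hk₃⟩
  refine ⟨by simpa using hl, by simp; nlinarith, i, by simpa using hk₃, ?_, hd⟩
  rw [hf₃.1 5 (by simp)]
  simpa using hi'

end

/-! ### Binary search for the further pegs -/

/-- Counting the known pegs that are correct in the guess. -/
def tally : Program :=
  .setReg 7 (.lit 0) ;;
  .setReg 3 (.lit 0) ;;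
  .loop (.sub (.reg 0) (.reg 3))
    (.ite (.arr 3 (.reg 3))
        (.ite (.add (.sub (.arr 0 (.reg 3)) (.arr 2 (.reg 3)))
            (.sub (.arr 2 (.reg 3)) (.arr 0 (.reg 3)))) .skip
          (.setReg 7 (.add (.reg 7) (.lit 1)))) .skip ;;
      .setReg 3 (.add (.reg 3) (.lit 1)))

/-- Binary search between the offsets `reg 13` and `reg 14`. -/
def halve : Program :=
  .loop (.sub (.sub (.reg 14) (.reg 13)) (.lit 1))
    (.setReg 6 (.half (.add (.reg 13) (.reg 14))) ;;
      ask ;;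
      tally ;;
      .ite (.sub (.reg 2) (.reg 7)) (.setReg 14 (.reg 6)) (.setReg 13 (.reg 6)))

/-- Finding and recording one more peg. -/
def next : Program :=
  find ;;
  .setReg 13 (.lit 0) ;;
  .setReg 14 (.sub (.reg 0) (.lit 1)) ;;
  halve ;;
  .setReg 10 (.arr 4 (.add (.reg 5) (.add (.reg 4) (.add (.lit 1) (.reg 13))))) ;;
  .setReg 11 (.arr 4 (.add (.reg 5) (.add (.reg 13) (.lit 1)))) ;;
  record

/-- Guessing the secret once at most one peg is unknown. -/
def finish : Program :=
  find ;;
  .setReg 1 (.lit 0) ;;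
  .loop (.sub (.reg 0) (.reg 1))
    (.ite (.arr 3 (.reg 1)) .skip
        (.setArr 0 (.reg 1) (.arr 4 (.sub (.add (.reg 0) (.reg 1)) (.reg 4)))) ;;
      .setReg 1 (.add (.reg 1) (.lit 1))) ;;
  .query 0 2

/-- The strategy of the codebreaker. -/
def strategy : Program :=
  mkTable ;; shifts ;; first ;; .loop (.sub (.reg 12) (.lit 1)) next ;; finish

section

variable {n : ℕ} {y : Equiv.Perm (Fin n)} {M M' : Memory} {S : Finset (Fin n)}

/-- The number of known pegs that are correct in the guess `x`. -/
def knownBlack (x y : Equiv.Perm (Fin n)) (S : Finset (Fin n)) : ℕ :=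
  (S.filter fun i => x i = y i).card

theorem knownBlack_lt_black_iff {x : Equiv.Perm (Fin n)} :
    knownBlack x y S < black x y ↔ ∃ i ∉ S, x i = y i := by
  have hsub : S.filter (fun i => x i = y i) ⊆ Finset.univ.filter fun i => x i = y i :=
    Finset.filter_subset_filter _ (Finset.subset_univ _)
  constructor
  · intro h
    obtain ⟨i, hi, hi'⟩ := Finset.exists_mem_notMem_of_card_lt_card h
    simp only [Finset.mem_filter, Finset.mem_univ, true_and, not_and] at hi hi'
    exact ⟨i, fun h => hi' h hi, hi⟩
  · rintro ⟨i, hi, hi'⟩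
    refine Finset.card_lt_card (Finset.ssubset_iff_of_subset hsub |>.2 ⟨i, by simp [hi'], ?_⟩)
    simp [hi]

theorem ends_tally (h : Known y S M) {x : Equiv.Perm (Fin n)}
    (hx : ∀ i : Fin n, M.arr 2 i = x i) : Ends y tally M fun M' t qs =>
      qs = [] ∧ t ≤ 100 * (n + 1) ∧ Frame [3, 7] [] M M' ∧ M'.reg 7 = knownBlack x y S := by
  simp only [tally, ends_seq, ends_setReg]
  refine (ends_loop (fun M' qs => qs = [] ∧ Frame [3, 7] [] M M' ∧ M'.reg 3 ≤ n ∧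
    M'.reg 7 = (S.filter fun i : Fin n => (i : ℕ) < M'.reg 3 ∧ x i = y i).card)
    (fun M' => n - M'.reg 3) 40 ?_ ?_).mono ?_
  · exact ⟨rfl, (Frame.refl.setReg (by simp)).setReg (by simp), by simp, by simp⟩
  · rintro M₁ qs ⟨rfl, hf, h3, h7⟩ he
    have hk := h.frame hf (by simp) (by simp)
    have h0 := hk.base.1
    simp only [Expr.eval, h0] at he
    obtain ⟨i, hi⟩ : ∃ i : Fin n, (i : ℕ) = M₁.reg 3 := ⟨⟨M₁.reg 3, by omega⟩, rfl⟩
    have hx' : M₁.arr 2 (M₁.reg 3) = x i := by rw [hf.2 2 (by simp), ← hi, hx]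
    have hm : M₁.arr 3 (M₁.reg 3) = if i ∈ S then 1 else 0 := by rw [← hi, hk.mark]
    have key : (S.filter fun j : Fin n => (j : ℕ) < M₁.reg 3 + 1 ∧ x j = y j).card =
        M₁.reg 7 + if i ∈ S ∧ x i = y i then 1 else 0 := by
      rw [h7]
      split_ifs with hc
      · rw [← Finset.card_insert_of_notMem (a := i) (by simp [hi])]
        congr 1
        ext j
        simp only [Finset.mem_filter, Finset.mem_insert]
        constructor
        · rintro ⟨h1, h2, h3⟩
          obtain h2 | h2 := Nat.lt_succ_iff_lt_or_eq.1 h2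
          · exact Or.inr ⟨h1, h2, h3⟩
          · exact Or.inl (Fin.ext (h2.trans hi.symm))
        · rintro (rfl | ⟨h1, h2, h3⟩)
          · exact ⟨hc.1, by omega, hc.2⟩
          · exact ⟨h1, by omega, h3⟩
      · rw [add_zero]
        congr 1
        ext j
        simp only [Finset.mem_filter]
        constructor
        · rintro ⟨h1, h2, h3⟩
          obtain h2 | h2 := Nat.lt_succ_iff_lt_or_eq.1 h2
          · exact ⟨h1, h2, h3⟩
          · obtain rfl : j = i := Fin.ext (h2.trans hi.symm)
            exact absurd ⟨h1, h3⟩ hc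
        · rintro ⟨h1, h2, h3⟩
          exact ⟨h1, by omega, h3⟩
    simp only [ends_seq, ends_setReg, ends_ite, ends_skip, Expr.eval, Expr.cost,
      Memory.setReg_reg, Nat.reduceEqDiff, if_false, if_true, hx', hm, key]
    by_cases hiS : i ∈ S
    · have hp : M₁.arr 0 (M₁.reg 3) = y i := by rw [← hi, hk.peg i hiS]
      rw [if_pos hiS, if_neg one_ne_zero, hp]
      by_cases hc : x i = y i
      · rw [if_pos (by rw [hc]; omega), if_pos ⟨hiS, hc⟩]
        exact ⟨by norm_num, ⟨rfl, (hf.setReg (by simp)).setReg (by simp), by omega, rfl⟩, by omega⟩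
      · rw [if_neg (by have := Fin.val_ne_of_ne hc; omega), if_neg (fun h => hc h.2)]
        exact ⟨by norm_num, ⟨rfl, hf.setReg (by simp), by omega, rfl⟩, by omega⟩
    · rw [if_neg hiS, if_pos rfl, if_neg (fun h => hiS h.1)]
      exact ⟨by norm_num, ⟨rfl, hf.setReg (by simp), by omega, rfl⟩, by omega⟩
  · rintro M₁ t qs ⟨⟨rfl, hf, h3, h7⟩, he, ht⟩
    have h0 : M₁.reg 0 = n := by rw [hf.1 0 (by simp), h.base.1]
    simp only [Expr.eval, h0] at he
    simp [Expr.cost] at ht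
    refine ⟨rfl, by simp [Expr.cost]; omega, hf, ?_⟩
    rw [h7, knownBlack, show M₁.reg 3 = n by omega]
    simp

/-- This pays for one guess of the binary search out of the width of the bracket. -/
theorem clog_halves {w k : ℕ} (hw : 1 < w) (hk : k ≤ (w + 1) / 2) :
    Nat.clog 2 k + 1 ≤ Nat.clog 2 w := by
  rw [Nat.clog_of_two_le (b := 2) (by norm_num) hw]
  have := Nat.clog_mono_right 2 (n := k) (m := (w + 2 - 1) / 2) (by omega)
  simpa using this

/-- An unknown peg on the diagonal `d` has an offset less than `m`. -/
def HasBefore (y : Equiv.Perm (Fin n)) (S : Finset (Fin n)) (d q m : ℕ) : Prop :=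
  ∃ t < m, ∃ i : Fin n, (i : ℕ) = (q + d + 1 + t) % n ∧ i ∉ S ∧ diag y i = d

/-- The unknown pegs on the diagonal `d` all have at least the offset `a`, and one has an offset
less than `b`. -/
def Bracket (y : Equiv.Perm (Fin n)) (S : Finset (Fin n)) (d q a b : ℕ) : Prop :=
  (∀ t < n, ∀ i : Fin n, (i : ℕ) = (q + d + 1 + t) % n → i ∉ S → diag y i = d → a ≤ t) ∧
    HasBefore y S d q b

/-- A surplus hit is at an unknown position. It is not on diagonal `d + 1`, which has no unknown
peg, nor at the filler, whose colour belongs to the known position `p`; so it is on diagonal `d`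
before the cut. -/
theorem knownBlack_lt_black_hybrid_iff {d q m : ℕ} (hd : d < n) (hm : m < n) {p : Fin n}
    (hp : p ∈ S) (hq : (y p : ℕ) = q) (hz : count y S ((d + 1) % n) = 0) :
    knownBlack (hybrid n d q m) y S < black (hybrid n d q m) y ↔ HasBefore y S d q m := by
  have hqn : q < n := hq ▸ (y p).2
  rw [knownBlack_lt_black_iff]
  constructor
  · rintro ⟨i, hi, hx⟩
    obtain ⟨t, ht, hit⟩ := exists_add_mod (q + d + 1) i i.2
    rcases (hybrid_apply_eq_iff y hd hqn hm ht hit.symm).1 hx with h | h | h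
    · exact ⟨t, h.1, i, hit.symm, hi, h.2⟩
    · exact absurd h.2 ((count_eq_zero_iff y).1 hz i hi)
    · obtain rfl : i = p := y.injective (Fin.ext (h.2.trans hq.symm))
      exact absurd hp hi
  · rintro ⟨t, ht, i, hi, hiS, hdi⟩
    exact ⟨i, hiS, (hybrid_apply_eq_iff y hd hqn hm (ht.trans hm) hi).2 (Or.inl ⟨ht, hdi⟩)⟩

theorem ends_halve (h : Known y S M) {d q : ℕ} (h4 : M.reg 4 = d) (h5 : M.reg 5 = q) (hd : d < n)
    {p : Fin n} (hp : p ∈ S) (hq : (y p : ℕ) = q) (hz : count y S ((d + 1) % n) = 0)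
    (h13 : M.reg 13 = 0) (h14 : M.reg 14 = n - 1) (hb : Bracket y S d q 0 (n - 1)) :
    Ends y halve M fun M' t qs => qs.length ≤ Nat.clog 2 (n - 1) ∧ t ≤ 1000 * (n + 1) ^ 2 ∧
      Frame [2, 3, 6, 7, 13, 14] [2] M M' ∧
      ∃ i : Fin n, (i : ℕ) = (q + d + 1 + M'.reg 13) % n ∧ M'.reg 13 < n ∧ i ∉ S ∧ diag y i = d := by
  have hqn : q < n := hq ▸ (y p).2
  refine (ends_loop (fun M' qs =>
    qs.length + Nat.clog 2 (M'.reg 14 - M'.reg 13) ≤ Nat.clog 2 (n - 1) ∧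
    Frame [2, 3, 6, 7, 13, 14] [2] M M' ∧ M'.reg 14 ≤ n - 1 ∧
    Bracket y S d q (M'.reg 13) (M'.reg 14))
    -- The width itself suffices as variant for a polynomial time bound; the logarithm matters only
    -- for the number of guesses.
    (fun M' => M'.reg 14 - M'.reg 13) (400 * (n + 1)) ?_ ?_).mono ?_
  · simp only [h13, h14]
    exact ⟨by simp, Frame.refl, le_rfl, hb⟩
  · rintro M₁ qs ⟨hl, hf, h14, hB⟩ he
    have hk := h.frame hf (by simp) (by simp)
    rw [← hf.1 4 (by simp)] at h4
    rw [← hf.1 5 (by simp)] at h5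
    simp only [Expr.eval] at he
    rw [ends_seq, ends_setReg, ends_seq]
    set m := (M₁.reg 13 + M₁.reg 14) / 2 with hm
    have hmn : m < n := by omega
    have hk₂ := hk.frame (M' := M₁.setReg 6 m) (rs := [6]) (as := []) (Frame.refl.setReg (by simp))
      (by simp) (by simp)
    refine (ends_ask hk₂.base (by simpa using h4) (by simpa using h5) (by simp) hd hqn
      hmn).mono ?_
    rintro M₃ t₃ _ ⟨rfl, ht₃, hf₃, hr₃, hA₃⟩
    have hk₃ := hk₂.frame hf₃ (by simp) (by simp)
    rw [ends_seq]
    refine (ends_tally hk₃ hA₃).mono ?_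
    rintro M₄ t₄ _ ⟨rfl, ht₄, hf₄, hr₄⟩
    have hff : Frame [2, 3, 6, 7, 13, 14] [2] M M₄ :=
      ((hf.setReg (by simp)).trans hf₃ (by simp) (by simp)).trans hf₄ (by simp) (by simp)
    have g13 : M₄.reg 13 = M₁.reg 13 := by
      rw [hf₄.1 13 (by simp), hf₃.1 13 (by simp)]; simp
    have g14 : M₄.reg 14 = M₁.reg 14 := by
      rw [hf₄.1 14 (by simp), hf₃.1 14 (by simp)]; simp
    have g6 : M₄.reg 6 = m := by
      rw [hf₄.1 6 (by simp), hf₃.1 6 (by simp)]; simp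
    have g2 : M₄.reg 2 = black (hybrid n d q m) y := by rw [hf₄.1 2 (by simp), hr₃]
    have key := knownBlack_lt_black_hybrid_iff hd hmn hp hq hz
    simp only [ends_setReg, ends_ite, Expr.eval, Expr.cost, Memory.setReg_reg, Nat.reduceEqDiff,
      if_false, if_true, g2, g6, g13, g14, hr₄]
    by_cases hc : knownBlack (hybrid n d q m) y S < black (hybrid n d q m) y
    · rw [if_neg (by omega)]
      have hcl := clog_halves (w := M₁.reg 14 - M₁.reg 13) (k := m - M₁.reg 13)
        (by omega) (by omega)
      exact ⟨by omega, ⟨by simp; omega, hff.setReg (by simp), by omega, hB.1, key.1 hc⟩, by omega⟩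
    · rw [if_pos (by omega)]
      have hcl := clog_halves (w := M₁.reg 14 - M₁.reg 13) (k := M₁.reg 14 - m)
        (by omega) (by omega)
      refine ⟨by omega, ⟨by simp; omega, hff.setReg (by simp), by omega,
        fun t ht i hi hiS hdi => ?_, hB.2⟩, by omega⟩
      by_contra hlt
      exact hc (key.2 ⟨t, by omega, i, hi, hiS, hdi⟩)
  · rintro M₁ t qs ⟨⟨hl, hf, h14', hB⟩, he, ht⟩
    simp only [Expr.eval] at he
    obtain ⟨t', ht', i, hi, hiS, hdi⟩ := hB.2
    have := hB.1 t' (by omega) i hi hiS hdi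
    -- A bracket of width at most one leaves a single offset.
    obtain rfl : t' = M₁.reg 13 := by omega
    refine ⟨by omega, ?_, hf, i, hi, by omega, hiS, hdi⟩
    simp only [h13, h14, Expr.cost] at ht
    rw [show n - 1 - 0 + 1 = n by omega] at ht
    nlinarith

theorem ends_next (h : Known y S M) {p : Fin n} (hp : p ∈ S) (h5 : M.reg 5 = y p)
    (hS : S.card < n) (hz : ∃ d < n, count y S d = 0) :
    Ends y next M fun M' t qs => qs.length ≤ Nat.clog 2 (n - 1) ∧ t ≤ 2000 * (n + 1) ^ 2 ∧
      M'.reg 5 = y p ∧ M'.reg 12 + 1 = M.reg 12 ∧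
      ∃ i ∉ S, Known y (insert i S) M' ∧ ∃ d < n, count y (insert i S) d = 0 := by
  have hn : 0 < n := p.pos
  rw [next, ends_seq]
  refine (ends_find h.base).mono ?_
  rintro M₁ t₁ _ ⟨rfl, ht₁, hf₁, hd⟩
  have hk₁ := h.frame hf₁ (by simp) (by simp)
  obtain ⟨j, hj⟩ : ∃ j, j ∉ S := by
    by_contra! hall
    rw [Finset.eq_univ_of_forall hall] at hS
    simp at hS
  obtain ⟨h4, h6, h7⟩ : M₁.reg 4 < n ∧ count y S (M₁.reg 4) ≠ 0 ∧
      count y S ((M₁.reg 4 + 1) % n) = 0 := by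
    rcases hd with ⟨h4, h6, h7⟩ | ⟨-, h6⟩
    · rw [h.count _ h4] at h6
      rw [h.count _ (Nat.mod_lt _ hn)] at h7
      exact ⟨h4, h6, h7⟩
    · obtain ⟨a, ha, ha', ha''⟩ := exists_pos_zero_succ (count y S)
        ⟨diag y j, diag_lt _ _, ((count_pos_iff y).2 ⟨j, hj, rfl⟩).ne'⟩ hz
      rw [← h.count _ ha] at ha'
      rw [← h.count _ (Nat.mod_lt _ hn)] at ha''
      exact absurd ha'' (h6 a ha ha')
  rw [← hf₁.1 5 (by simp)] at h5
  have h0 := hk₁.base.1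
  rw [ends_seq, ends_setReg, ends_seq, ends_setReg, ends_seq]
  have hf₂ : Frame [13, 14] [] M₁ ((M₁.setReg 13 0).setReg 14 (n - 1)) :=
    (Frame.refl.setReg (by simp)).setReg (by simp)
  simp only [Expr.eval, Memory.setReg_reg, OfNat.zero_ne_ofNat, if_false, h0]
  have hk₂ := hk₁.frame hf₂ (by simp) (by simp)
  refine (ends_halve hk₂ (hf₂.1 4 (by simp)) (q := y p) (by simpa using h5) h4 hp rfl h7 (by simp)
    (by simp) ⟨fun _ _ _ _ _ _ => Nat.zero_le _, ?_⟩).mono ?_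
  · obtain ⟨i, hi, hdi⟩ := (count_pos_iff y).1 (Nat.pos_of_ne_zero h6)
    obtain ⟨t, ht, hit⟩ := exists_add_mod (y p + M₁.reg 4 + 1) i i.2
    refine ⟨t, ?_, i, hit.symm, hi, hdi⟩
    -- At offset `n - 1` diagonal `d` carries the colour of the known peg `p`, so the upper end `n -
    -- 1` is legitimate.
    by_contra hlt
    have := apply_eq_of_diag_eq y hit.symm hdi
    rw [show t + 1 = n by omega, Nat.add_mod_right, Nat.mod_eq_of_lt (y p).2] at this
    exact hi (y.injective (Fin.ext this) ▸ hp)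
  · rintro M₃ t₃ qs ⟨hl, ht₃, hf₃, i, hi, h13, hiS, hdi⟩
    have hk₃ := hk₂.frame hf₃ (by simp) (by simp)
    have hyi := apply_eq_of_diag_eq y hi hdi
    have g4 : M₃.reg 4 = M₁.reg 4 := by rw [hf₃.1 4 (by simp)]; simp
    have g5 : M₃.reg 5 = y p := by rw [hf₃.1 5 (by simp), ← h5]; simp
    have e1 : M₃.arr 4 (y p + (M₁.reg 4 + (1 + M₃.reg 13))) = i := by
      rw [hk₃.base.2 _ (by omega), hi]; congr 1; omega
    have e2 : M₃.arr 4 (y p + (M₃.reg 13 + 1)) = y i := by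
      rw [hk₃.base.2 _ (by omega), hyi]
    rw [ends_seq, ends_setReg, ends_seq, ends_setReg]
    simp only [Expr.eval, g4, g5, e1, Memory.setReg_reg, Memory.setReg_arr, Nat.reduceEqDiff,
      if_false, e2, Expr.cost]
    have hf₄ : Frame [10, 11] [] M₃ ((M₃.setReg 10 i).setReg 11 (y i)) :=
      (Frame.refl.setReg (by simp)).setReg (by simp)
    have hk₄ := hk₃.frame hf₄ (by simp) (by simp)
    refine (ends_record hk₄ hiS (by simp) (by simp)).mono ?_
    rintro M₅ t₅ _ ⟨rfl, ht₅, hf₅, hk₅⟩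
    refine ⟨by simpa using hl, by nlinarith, ?_, ?_, i, hiS, hk₅, ?_⟩
    · rw [hf₅.1 5 (by simp), hf₄.1 5 (by simp), g5]
    · have h1 := hk₅.rest
      have h2 := h.rest
      rw [Finset.card_insert_of_notMem hiS] at h1
      omega
    · obtain ⟨d, hd, hd'⟩ := hz
      refine ⟨d, hd, ?_⟩
      rw [count_insert y hiS]
      split_ifs <;> omega

/-! ### The final guess and the number of queries -/

theorem ends_finish (h : Known y S M) (hn : 0 < n) (hS : n ≤ S.card + 1)
    (hz : ∃ d < n, count y S d = 0) :
    Ends y finish M fun M' t qs => qs = [y] ∧ t ≤ 500 * (n + 1) ∧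
      ∀ i : Fin n, M'.arr 0 i = y i := by
  rw [finish, ends_seq]
  refine (ends_find h.base).mono ?_
  rintro M₁ t₁ _ ⟨rfl, ht₁, hf₁, hd⟩
  have hk₁ := h.frame hf₁ (by simp) (by simp)
  -- At most one position is unknown; if there is one, its diagonal is the only nonempty one, and
  -- `find` returns it.
  have h4 : ∀ i, i ∉ S → M₁.reg 4 = diag y i := by
    intro i hi
    have huniq : ∀ j, j ∉ S → j = i := by
      intro j hj
      by_contra hne
      have := (insert j (insert i S)).card_le_univ
      rw [Finset.card_insert_of_notMem (by simp [hne, hj]), Finset.card_insert_of_notMem hi,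
        Fintype.card_fin] at this
      omega
    rcases hd with ⟨h4, h6, -⟩ | ⟨-, h6⟩
    · rw [h.count _ h4] at h6
      obtain ⟨j, hj, hdj⟩ := (count_pos_iff y).1 (Nat.pos_of_ne_zero h6)
      rw [← hdj, huniq j hj]
    · obtain ⟨a, ha, ha', ha''⟩ := exists_pos_zero_succ (count y S)
        ⟨diag y i, diag_lt _ _, ((count_pos_iff y).2 ⟨i, hi, rfl⟩).ne'⟩ hz
      rw [← h.count _ ha] at ha'
      rw [← h.count _ (Nat.mod_lt _ hn)] at ha''
      exact absurd ha'' (h6 a ha ha')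
  rw [ends_seq, ends_setReg, ends_seq]
  simp only [Expr.eval]
  refine (ends_loop (fun M' qs => qs = [] ∧ Frame [1] [0] M₁ M' ∧ M'.reg 1 ≤ n ∧
    ∀ i : Fin n, i ∈ S ∨ (i : ℕ) < M'.reg 1 → M'.arr 0 i = y i)
    (fun M' => n - M'.reg 1) 40 ?_ ?_).mono ?_
  · exact ⟨rfl, Frame.refl.setReg (by simp), by simp, by simpa using hk₁.peg⟩
  · rintro M₂ qs ⟨rfl, hf, h1, hA⟩ he
    have h0 : M₂.reg 0 = n := by rw [hf.1 0 (by simp), hk₁.base.1]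
    simp only [Expr.eval, h0] at he
    obtain ⟨i, hi⟩ : ∃ i : Fin n, (i : ℕ) = M₂.reg 1 := ⟨⟨M₂.reg 1, by omega⟩, rfl⟩
    have hm : M₂.arr 3 (M₂.reg 1) = if i ∈ S then 1 else 0 := by
      rw [← hi, hf.2 3 (by simp), hk₁.mark]
    simp only [ends_seq, ends_setReg, ends_setArr, ends_ite, ends_skip, Expr.eval, Expr.cost,
      Memory.setArr_reg, hm]
    by_cases hiS : i ∈ S
    · rw [if_pos hiS, if_neg one_ne_zero]
      refine ⟨by norm_num, ⟨rfl, hf.setReg (by simp), by simp; omega, fun j hj => ?_⟩,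
        by simp; omega⟩
      simp only [Memory.setReg_reg, if_true, Memory.setReg_arr] at hj ⊢
      by_cases hji : j = i
      · exact hA j (Or.inl (hji ▸ hiS))
      · have := Fin.val_ne_of_ne hji
        exact hA j (hj.imp_right fun _ => by omega)
    · rw [if_neg hiS, if_pos rfl]
      refine ⟨by norm_num, ⟨rfl, (hf.setArr (by simp)).setReg (by simp), by simp; omega,
        fun j hj => ?_⟩, by simp; omega⟩
      simp only [Memory.setReg_reg, if_true, Memory.setReg_arr, Memory.setArr_arr, true_and] at hj ⊢
      by_cases hji : j = i
      · subst hji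
        rw [if_pos hi, h0, ← hi, hf.1 4 (by simp), h4 j hiS, hf.2 4 (by simp),
          hk₁.base.2 _ (by omega)]
        have hlt := diag_lt y j
        refine add_mod_cancel (a := diag y j) (Nat.mod_lt _ hn) (y j).2 ?_
        rw [Nat.add_mod_mod, show diag y j + (n + j - diag y j) = j + n by omega,
          Nat.add_mod_right, Nat.mod_eq_of_lt j.2, add_comm, add_diag_mod]
      · have := Fin.val_ne_of_ne hji
        rw [if_neg (by omega)]
        exact hA j (hj.imp_right fun _ => by omega)
  · rintro M₂ t₂ qs ⟨⟨rfl, hf, h1, hA⟩, he, ht⟩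
    have h0 : M₂.reg 0 = n := by rw [hf.1 0 (by simp), hk₁.base.1]
    simp only [Expr.eval, h0] at he
    have hA' : ∀ i : Fin n, M₂.arr 0 i = y i := fun i => hA i (Or.inr (by omega))
    refine ends_query y hA' ⟨rfl, ?_, hA'⟩
    simp at ht ⊢
    omega

theorem ends_strategy (hn : 0 < n) (y : Equiv.Perm (Fin n)) :
    Ends y strategy (Memory.init n) fun M' t qs =>
      t ≤ 10000 * (n + 1) ^ 3 ∧ (List.range (n - 1)).map (cyclicShift n) <+: qs ∧
      qs.getLast? = some y ∧ (∀ i : Fin n, M'.arr 0 i = y i) ∧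
      qs.length ≤ 2 * (n - 1) + (n - 2) * Nat.clog 2 (n - 1) + 1 := by
  rw [strategy, ends_seq]
  refine (ends_mkTable (by simp [Memory.init])).mono ?_
  rintro M₁ t₁ _ ⟨rfl, ht₁, hb₁, hf₁⟩
  rw [ends_seq]
  refine (ends_shifts hb₁ hn (by rw [hf₁.2 3 (by simp)]; simp [Memory.init])).mono ?_
  rintro M₂ t₂ _ ⟨rfl, ht₂, hk₂⟩
  rw [ends_seq]
  refine (ends_first hk₂ hn).mono ?_
  rintro M₃ t₃ qs₃ ⟨hl₃, ht₃, p, hk₃, h5, hz₃⟩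
  rw [ends_seq]
  -- The first peg `p` supplies the filler for every search. The maximum in the bound on `S.card`
  -- accommodates `n = 1`, where the first peg is already the last.
  refine (ends_loop (fun M' qs => ∃ S, Known y S M' ∧ p ∈ S ∧ M'.reg 5 = y p ∧
    (∃ d < n, count y S d = 0) ∧ qs.length ≤ (S.card - 1) * Nat.clog 2 (n - 1) ∧
    S.card ≤ max 1 (n - 1)) (fun M' => M'.reg 12) (2000 * (n + 1) ^ 2) ?_ ?_).mono ?_
  · exact ⟨{p}, hk₃, by simp, h5, hz₃, by simp, by simp⟩
  · rintro M₄ qs ⟨S, hk₄, hp, h5, hz, hl, hS⟩ he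
    simp only [Expr.eval] at he
    have hr := hk₄.rest
    refine (ends_next hk₄ hp h5 (by omega) hz).mono ?_
    rintro M₅ t₅ qs₅ ⟨hl₅, ht₅, h5', h12, i, hi, hk₅, hz₅⟩
    refine ⟨ht₅, ⟨_, hk₅, Finset.mem_insert_of_mem hp, h5', hz₅, ?_, ?_⟩, by omega⟩
    · have hpos : 0 < S.card := Finset.card_pos.2 ⟨p, hp⟩
      rw [Finset.card_insert_of_notMem hi, List.length_append, add_tsub_cancel_right]
      obtain ⟨c, hc⟩ : ∃ c, S.card = c + 1 := ⟨S.card - 1, by omega⟩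
      rw [hc] at hl ⊢
      rw [add_tsub_cancel_right] at hl
      linarith
    · rw [Finset.card_insert_of_notMem hi]
      omega
  · rintro M₄ t₄ qs₄ ⟨⟨S, hk₄, hp, h5, hz, hl, hS⟩, he, ht₄⟩
    simp only [Expr.eval] at he
    have hr := hk₄.rest
    refine (ends_finish hk₄ hn (by omega) hz).mono ?_
    rintro M₅ t₅ _ ⟨rfl, ht₅, hA⟩
    refine ⟨?_, ?_, ?_, hA, ?_⟩
    · have h12 : M₃.reg 12 ≤ n := by have := hk₃.rest; omega
      have : (M₃.reg 12 + 1) * (2000 * (n + 1) ^ 2 + (Expr.sub (.reg 12) (.lit 1)).cost + 1) ≤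
          (n + 1) * (2000 * (n + 1) ^ 2 + 4) := Nat.mul_le_mul (by omega) (by simp)
      nlinarith
    · simp
    · simp [← List.append_assoc]
    · have : (S.card - 1) * Nat.clog 2 (n - 1) ≤ (n - 2) * Nat.clog 2 (n - 1) :=
        Nat.mul_le_mul_right _ (by omega)
      simp
      omega

theorem two_mul_clog_le : 6 ≤ n → 2 * Nat.clog 2 n ≤ n := by
  intro h
  have h1 : n ≤ 2 ^ (n / 2) := by
    obtain ⟨k, hk⟩ : ∃ k, n / 2 = k + 3 := ⟨n / 2 - 3, by omega⟩
    have : ∀ k, 2 * (k + 3) + 1 ≤ 2 ^ (k + 3) := by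
      intro k
      induction k with
      | zero => norm_num
      | succ k ih => rw [show k + 1 + 3 = k + 3 + 1 by omega, pow_succ]; omega
    have := this k
    rw [hk]; omega
  have := Nat.clog_le_of_le_pow h1
  omega

/-- After replacing `clog 2 (n - 1)` by `clog 2 n`, what remains is `clog 2 n ≤ n / 2`, valid from
`n = 6` on. Smaller `n` are checked one by one; `n = 2` gives equality. -/
theorem query_bound (hn : 0 < n) :
    ((2 * (n - 1) + (n - 2) * Nat.clog 2 (n - 1) + 1 : ℕ) : ℝ) ≤
      ((n : ℝ) - 3) * (Nat.clog 2 n : ℝ) + 5 / 2 * (n : ℝ) - 1 := by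
  rcases lt_or_ge n 6 with h | h
  · interval_cases n <;>
      simp [Nat.clog_of_two_le] <;> norm_num
  · have h1 := two_mul_clog_le h
    have h2 : (n - 2) * Nat.clog 2 (n - 1) ≤ (n - 2) * Nat.clog 2 n :=
      Nat.mul_le_mul_left _ (Nat.clog_mono_right 2 (by omega))
    obtain ⟨k, rfl⟩ := Nat.exists_eq_add_of_le h
    rw [show 6 + k - 2 = k + 4 by omega] at *
    rw [show 6 + k - 1 = k + 5 by omega] at *
    have h1' : (2 * Nat.clog 2 (6 + k) : ℝ) ≤ 6 + k := by exact_mod_cast h1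
    have h2' : ((k + 4 : ℝ) * Nat.clog 2 (k + 5)) ≤ (k + 4) * Nat.clog 2 (6 + k) := by
      exact_mod_cast h2
    push_cast
    linarith

end

end Mastermind

theorem mainTheorem1 :
    ∃ (p : Mastermind.Program) (T : Polynomial ℕ),
      ∀ (n : ℕ), 1 ≤ n → ∀ y : Equiv.Perm (Fin n),
        ∃ (M : Mastermind.Memory) (t : ℕ) (qs : List (Equiv.Perm (Fin n))),
          Mastermind.Run y p (Mastermind.Memory.init n) M t qs ∧
          t ≤ T.eval n ∧
          (List.range (n - 1)).map (Mastermind.cyclicShift n) <+: qs ∧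
          qs.getLast? = some y ∧
          (∀ i : Fin n, M.arr 0 (i : ℕ) = (y i : ℕ)) ∧
          (qs.length : ℝ) ≤
            ((n : ℝ) - 3) * (⌈Real.logb 2 (n : ℝ)⌉ : ℝ) + 5 / 2 * (n : ℝ) - 1 := by
  refine ⟨Mastermind.strategy, 10000 * (Polynomial.X + 1) ^ 3, fun n hn y => ?_⟩
  obtain ⟨M, t, qs, hrun, ht, hpre, hlast, harr, hlen⟩ := Mastermind.ends_strategy hn y
  refine ⟨M, t, qs, hrun, by simpa using ht, hpre, hlast, harr, ?_⟩
  have hlog : ⌈Real.logb 2 (n : ℝ)⌉ = (Nat.clog 2 n : ℤ) := by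
    exact_mod_cast Real.ceil_logb_natCast (b := 2) (Nat.cast_nonneg n)
  rw [hlog, Int.cast_natCast]
  exact (Nat.cast_le.2 hlen).trans (Mastermind.query_bound hn)
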